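/- A cylinder category is a category $\mathcal C$ with two classes of maps, cofibrations and weak equivalences (a trivial cofibration is a map in both), such that: both classes contain the isomorphisms and are closed under composition; weak equivalences satisfy $2$-out-of-$6$; $\mathcal C$ has an initial object $0$ and every map $0\to X$ is a cofibration; pushouts of cofibrations along arbitrary maps exist and are cofibrations, and pushouts of trivial cofibrations are trivial cofibrations; for every object $X$ the codiagonal $X\sqcup X\to X$ factors as a cofibration followed by a weak equivalence; every trivial cofibration has a retraction. For a cofibration $A\to B$, a relative cylinder $I_AB$ is given by a factorization $B\sqcup_A B\to I_AB\to B$ of the codiagonal as a cofibration followed by a weak equivalence. A semi-model category is a complete and cocomplete category with classes of cofibrations, fibrations and weak equivalences satisfying the axioms of a Quillen model category (each class contains identities and is closed under composition and retracts, weak equivalences satisfy $2$-out-of-$3$, lifting, functorial factorization), except that acyclic cofibrations (cofibrations that are weak equivalences) are only required to have the left lifting property against fibrations when their domain is cofibrant, and that only maps with cofibrant domain are required to factor as an acyclic cofibration followed by a fibration; moreover the initial object is cofibrant, and fibrations and acyclic fibrations are stable under pullback. It is combinatorial, with sets $I$ and $J$ of generating cofibrations and generating trivial cofibrations, if it is locally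 presentable, the fibrations are the maps with the right lifting property against $J$, and the fibrations that are weak equivalences are the maps with the right lifting property against $I$. Let $\mathcal C$ be a small cylinder category, let $\widetilde{\mathcal C}$ be the category of presheaves of sets on $\mathcal C$ sending the initial object to a point and pushouts along cofibrations to pullbacks, and regard $\mathcal C$ as a full subcategory of $\widetilde{\mathcal C}$ by the Yoneda embedding. In $\widetilde{\mathcal C}$, call a map a cofibration if it is a retract of a cellular map, i.e. of a transfinite composition of pushouts of coproducts of cofibrations of $\mathcal C$; a fibration if it has the right lifting property against the trivial cofibrations of $\mathcal C$; a trivial cofibration if it has the left lifting property against all fibrations; and a weak equivalence a map $f:X\to Y$ such that for every cofibration $i:A\to B$ of $\mathcal C$ and all $s:A\to X$, $t:B\to Y$ with $fs=ti$ there are a map $a:B\to X$, a relative cylinder $I_AB$ and a map $h:I_AB\to Y$ such that $ai=s$ and the restrictions of $h$ along the two maps $B\rightrightarrows I_AB$ are $fa$ and $t$. **Theorem.** With these classes: 1. $\widetilde{\mathcal C}$ is a combinatorial semi-model category; the cofibrations and the trivial cofibrations of $\mathcal C$ are sets of generating cofibrations and generating trivial cofibrations. 2. Every object of $\widetilde{\mathcal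 C}$ is fibrant. 3. A map of $\widetilde{\mathcal C}$ with cofibrant domain is a trivial cofibration if and only if it is a cofibration and a weak equivalence. 4. For a cofibration $i:A\to B$ of $\mathcal C$, an object $X$ of $\widetilde{\mathcal C}$ and $x:A\to X$, the relation $f\sim_A g$ (there are a relative cylinder $I_AB$ and a map $I_AB\to X$ restricting to $f$ and $g$ along the two maps $B\rightrightarrows I_AB$) is an equivalence relation on $\{f:B\to X\mid fi=x\}$. Let $\pi_{B/A}(X,x)$ be its quotient. For a map $f:X\to X'$ the following are equivalent: (a) for all cofibrations $A\to B$ of $\mathcal C$ and all $x:A\to X$, the induced map $\pi_{B/A}(X,x)\to\pi_{B/A}(X',fx)$ is bijective; (b) all these maps are surjective; (c) $f$ is a weak equivalence. -/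

import Mathlib

open CategoryTheory CategoryTheory.Limits Opposite

universe u v w

namespace CylinderCat

/-! ### Cofibration categories and cylinder categories -/

section Basic

variable {C : Type u} [Category.{v} C]

/-- `Cof` is the class of cofibrations of a cofibration category structure on `C`. -/
structure IsCofibrationCategory (Cof : MorphismProperty C) : Prop where
  cof_of_isIso {X Y : C} (f : X ⟶ Y) [IsIso f] : Cof f
  cof_comp {X Y Z : C} (f : X ⟶ Y) (g : Y ⟶ Z) : Cof f → Cof g → Cof (f ≫ g)
  hasInitial : HasInitial C
  cof_from_initial {Z : C} (hZ : IsInitial Z) (X : C) : Cof (hZ.to X)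
  hasPushout {A B A' : C} (i : A ⟶ B) (f : A ⟶ A') : Cof i → HasPushout i f
  cof_pushout {A B A' B' : C} {i : A ⟶ B} {f : A ⟶ A'} {g : B ⟶ B'} {i' : A' ⟶ B'} :
    IsPushout i f g i' → Cof i → Cof i'

/-- A relative cylinder object `I_A B` for `i : A ⟶ B`: a factorization of the codiagonal
`B ∐_A B ⟶ B` as a cofibration followed by a weak equivalence. -/
structure RelCylinder (Cof W : MorphismProperty C) {A B : C} (i : A ⟶ B) where
  /-- the pushout `B ∐_A B` -/
  dbl : C
  inl : B ⟶ dbl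
  inr : B ⟶ dbl
  isPushout : IsPushout i i inl inr
  /-- the cylinder `I_A B` -/
  cyl : C
  incl : dbl ⟶ cyl
  proj : cyl ⟶ B
  cof_incl : Cof incl
  weq_proj : W proj
  inl_incl_proj : inl ≫ incl ≫ proj = 𝟙 B
  inr_incl_proj : inr ≫ incl ≫ proj = 𝟙 B

namespace RelCylinder

variable {Cof W : MorphismProperty C} {A B : C} {i : A ⟶ B}

/-- The first leg `B ⟶ I_A B`. -/
def leg₀ (K : RelCylinder Cof W i) : B ⟶ K.cyl := K.inl ≫ K.incl

/-- The second leg `B ⟶ I_A B`. -/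
def leg₁ (K : RelCylinder Cof W i) : B ⟶ K.cyl := K.inr ≫ K.incl

end RelCylinder

/-- `(C, Cof, W)` is a cylinder category. The pushout of two copies of `X` over the initial object
is the coproduct `X ∐ X`, so a cylinder object for `X` is one relative to the initial object. -/
structure IsCylinderCategory (Cof W : MorphismProperty C) : Prop
    extends IsCofibrationCategory Cof where
  weq_of_isIso {X Y : C} (f : X ⟶ Y) [IsIso f] : W f
  weq_comp {X Y Z : C} (f : X ⟶ Y) (g : Y ⟶ Z) : W f → W g → W (f ≫ g)
  two_out_of_six {X₀ X₁ X₂ X₃ : C} (f : X₀ ⟶ X₁) (g : X₁ ⟶ X₂) (h : X₂ ⟶ X₃) :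
    W (f ≫ g) → W (g ≫ h) → W f ∧ W g ∧ W h ∧ W (f ≫ g ≫ h)
  trivialCof_pushout {A B A' B' : C} {i : A ⟶ B} {f : A ⟶ A'} {g : B ⟶ B'} {i' : A' ⟶ B'} :
    IsPushout i f g i' → Cof i → W i → Cof i' ∧ W i'
  exists_cylinder {Z : C} (hZ : IsInitial Z) (X : C) : Nonempty (RelCylinder Cof W (hZ.to X))
  exists_retraction {A B : C} (i : A ⟶ B) : Cof i → W i → ∃ r : B ⟶ A, i ≫ r = 𝟙 A

end Basic

/-! ### Semi-model categories -/

section SemiModel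

variable {E : Type u} [Category.{v} E]

/-- The map from the initial object to `X` is a cofibration. -/
def IsCofibrantObject (cof : MorphismProperty E) (X : E) : Prop :=
  ∀ ⦃Z : E⦄ (hZ : IsInitial Z), cof (hZ.to X)

/-- The map from `X` to the terminal object is a fibration. -/
def IsFibrantObject (fib : MorphismProperty E) (X : E) : Prop :=
  ∀ ⦃T : E⦄ (hT : IsTerminal T), fib (hT.from X)

/-- The arrows with cofibrant domain. -/
def cofibrantDomain (cof : MorphismProperty E) : ObjectProperty (Arrow E) :=
  fun f ↦ IsCofibrantObject cof f.left

/-- Semi-model categories: as for Quillen model categories, except that acyclic cofibrations are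
only required to lift against fibrations when their domain is cofibrant, and that
only the maps with cofibrant domain are required to factor as an acyclic cofibration
followed by a fibration. Factorizations are functorial. -/
structure IsSemiModelCategory (cof fib weq : MorphismProperty E) : Prop where
  hasLimits : HasLimits E
  hasColimits : HasColimits E
  cof_isMultiplicative : cof.IsMultiplicative
  fib_isMultiplicative : fib.IsMultiplicative
  weq_isMultiplicative : weq.IsMultiplicative
  two_out_of_three : weq.HasTwoOutOfThreeProperty
  cof_retract : cof.IsStableUnderRetracts
  fib_retract : fib.IsStableUnderRetracts
  weq_retract : weq.IsStableUnderRetracts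
  fib_baseChange : fib.IsStableUnderBaseChange
  trivialFib_baseChange : (fib ⊓ weq).IsStableUnderBaseChange
  initial_cofibrant {Z : E} (hZ : IsInitial Z) : IsCofibrantObject cof Z
  lift_cof {A B X Y : E} (i : A ⟶ B) (p : X ⟶ Y) :
    cof i → fib p → weq p → HasLiftingProperty i p
  lift_acyclicCof {A B X Y : E} (i : A ⟶ B) (p : X ⟶ Y) :
    IsCofibrantObject cof A → cof i → weq i → fib p → HasLiftingProperty i p
  factor_trivialFib : MorphismProperty.HasFunctorialFactorization cof (fib ⊓ weq)
  factor_acyclicCof :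
    ∃ (Z : (cofibrantDomain cof).FullSubcategory ⥤ E)
      (i : (cofibrantDomain cof).ι ⋙ Arrow.leftFunc ⟶ Z)
      (p : Z ⟶ (cofibrantDomain cof).ι ⋙ Arrow.rightFunc),
      i ≫ p = Functor.whiskerLeft (cofibrantDomain cof).ι Arrow.leftToRight ∧
        ∀ f, cof (i.app f) ∧ weq (i.app f) ∧ fib (p.app f)

/-- Combinatorial semi-model categories, with sets `I` of generating cofibrations and
`J` of generating trivial cofibrations; `w` is the universe of small sets. -/
structure IsCombinatorialSemiModelCategory (cof fib weq I J : MorphismProperty E) : Prop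
    extends IsSemiModelCategory cof fib weq where
  isLocallyPresentable : IsLocallyPresentable.{w} E
  isSmall_I : MorphismProperty.IsSmall.{w} I
  isSmall_J : MorphismProperty.IsSmall.{w} J
  fib_iff {X Y : E} (p : X ⟶ Y) : fib p ↔ J.rlp p
  trivialFib_iff {X Y : E} (p : X ⟶ Y) : fib p ∧ weq p ↔ I.rlp p

end SemiModel

/-! ### The completion -/

section Completion

variable {C : Type u} [SmallCategory C]

/-- Presheaves sending initial objects to one-point sets and pushouts along cofibrations
to pullbacks. -/
def isModel (Cof : MorphismProperty C) : ObjectProperty (Cᵒᵖ ⥤ Type u) := fun F ↦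
  (∀ ⦃Z : C⦄, IsInitial Z → Nonempty (Unique (F.obj (op Z)))) ∧
  ∀ ⦃A B A' B' : C⦄ ⦃i : A ⟶ B⦄ ⦃f : A ⟶ A'⦄ ⦃g : B ⟶ B'⦄ ⦃i' : A' ⟶ B'⦄,
    Cof i → IsPushout i f g i' →
      IsPullback (F.map g.op) (F.map i'.op) (F.map i.op) (F.map f.op)

/-- The completion of `C`, a full subcategory of the category of presheaves. -/
abbrev Completion (Cof : MorphismProperty C) := (isModel Cof).FullSubcategory

lemma isModel_yoneda (Cof : MorphismProperty C) (X : C) : isModel Cof (yoneda.obj X) := by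
  refine ⟨fun Z hZ ↦ ⟨⟨⟨hZ.to X⟩, fun f ↦ hZ.hom_ext _ _⟩⟩, ?_⟩
  intro A B A' B' i f g i' _ sq
  exact (sq.op.map (yoneda.obj X)).flip

/-- The Yoneda embedding of `C` in its completion. -/
def y (Cof : MorphismProperty C) : C ⥤ Completion Cof :=
  (isModel Cof).lift yoneda (isModel_yoneda Cof)

variable (Cof W : MorphismProperty C)

/-- The cofibrations of `C`, as maps of the completion. -/
def genCof : MorphismProperty (Completion Cof) := Cof.strictMap (y Cof)

/-- The trivial cofibrations of `C`, as maps of the completion. -/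
def genTrivCof : MorphismProperty (Completion Cof) := (Cof ⊓ W).strictMap (y Cof)

/-- Cellular maps: transfinite compositions of pushouts of coproducts of cofibrations of `C`. -/
def cellular : MorphismProperty (Completion Cof) :=
  MorphismProperty.transfiniteCompositions.{u}
    (MorphismProperty.coproducts.{u} (genCof Cof)).pushouts

/-- The cofibrations of the completion: retracts of cellular maps. -/
def cof : MorphismProperty (Completion Cof) := (cellular Cof).retracts

/-- The fibrations of the completion. -/
def fib : MorphismProperty (Completion Cof) := (genTrivCof Cof W).rlp

/-- The weak equivalences of the completion: every square from a cofibration `i : A ⟶ B` of `C` to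
`f` has a filler `a` whose upper triangle commutes, and whose lower triangle commutes up to
a homotopy `h` relative to `A`. -/
def weq : MorphismProperty (Completion Cof) := fun X Y f ↦
  ∀ ⦃A B : C⦄ (i : A ⟶ B), Cof i → ∀ (s : (y Cof).obj A ⟶ X) (t : (y Cof).obj B ⟶ Y),
    s ≫ f = (y Cof).map i ≫ t →
      ∃ (K : RelCylinder Cof W i) (a : (y Cof).obj B ⟶ X) (h : (y Cof).obj K.cyl ⟶ Y),
        (y Cof).map i ≫ a = s ∧ (y Cof).map K.leg₀ ≫ h = a ≫ f ∧ (y Cof).map K.leg₁ ≫ h = t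

variable {Cof}

/-- Maps `B ⟶ X` extending `x : A ⟶ X` along `i : A ⟶ B`. -/
def Extension {A B : C} (i : A ⟶ B) {X : Completion Cof} (x : (y Cof).obj A ⟶ X) :=
  { f : (y Cof).obj B ⟶ X // (y Cof).map i ≫ f = x }

/-- Homotopy relative to `A`. -/
def RelHomotopic {A B : C} (i : A ⟶ B) {X : Completion Cof} (x : (y Cof).obj A ⟶ X)
    (f g : Extension i x) : Prop :=
  ∃ (K : RelCylinder Cof W i) (h : (y Cof).obj K.cyl ⟶ X),
    (y Cof).map K.leg₀ ≫ h = f.1 ∧ (y Cof).map K.leg₁ ≫ h = g.1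

/-- The set `π_{B/A}(X, x)`. -/
def PiSet {A B : C} (i : A ⟶ B) {X : Completion Cof} (x : (y Cof).obj A ⟶ X) : Type u :=
  Quot (RelHomotopic W i x)

/-- The map `π_{B/A}(X, x) → π_{B/A}(X', x ≫ φ)` induced by `φ : X ⟶ X'`. -/
def PiSet.map {A B : C} (i : A ⟶ B) {X X' : Completion Cof} (φ : X ⟶ X')
    (x : (y Cof).obj A ⟶ X) : PiSet W i x → PiSet W i (x ≫ φ) :=
  Quot.map (fun f ↦ ⟨f.1 ≫ φ, by rw [← Category.assoc, f.2]⟩) (by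
    rintro f g ⟨K, h, hf, hg⟩
    refine ⟨K, h ≫ φ, ?_, ?_⟩
    · rw [← Category.assoc, hf]
    · rw [← Category.assoc, hg])

end Completion

end CylinderCat

/-! The pivot is `weq_iff_factorsThrough`: a map `f` is a weak equivalence exactly when every square
from a cofibration of `C` to `f` factors through a weak equivalence of `C`. One direction reads a
homotopy as a square from `i` to a leg of its cylinder; the other rests on mapping cylinders in `C`
and on retractions of trivial cofibrations. This form is visibly stable under retracts, and under
filtered colimits because representables are finitely presentable. As the intermediate map may be
taken to be a trivial cofibration, it also gives `fib_and_weq_iff`.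

The small object argument supplies both factorizations. What remains is that a map in `(fib Cof
W).llp` with cofibrant domain is a weak equivalence. Cofibrant objects are flat, that is, filtered
colimits of representables. The pushout of a generating trivial cofibration along a map to a flat
object is a filtered colimit of pushouts computed in `C`, which are trivial cofibrations there;
hence it is a weak equivalence, and its codomain is again flat. `flatPushouts` is a class with
enough closure properties to propagate this to all retracts of cellular maps. Since flatness of the
domain is essential, only a semi-model structure results. The converse in `llp_fib_iff` is the
retract argument. -/

namespace CylinderCat

/-! ### Factorizations and lifts inside a cylinder category. -/

section CylinderCategory

variable {C : Type u} [Category.{v} C] {Cof W : MorphismProperty C}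

namespace IsCylinderCategory

lemma weq_of_precomp (hC : IsCylinderCategory Cof W) {X Y Z : C} (f : X ⟶ Y) (g : Y ⟶ Z)
    (hf : W f) (hfg : W (f ≫ g)) : W g :=
  (hC.two_out_of_six (𝟙 X) f g (by simpa using hf) hfg).2.2.1

lemma weq_of_postcomp (hC : IsCylinderCategory Cof W) {X Y Z : C} (f : X ⟶ Y) (g : Y ⟶ Z)
    (hg : W g) (hfg : W (f ≫ g)) : W f :=
  (hC.two_out_of_six f g (𝟙 Z) hfg (by simpa using hg)).1

lemma weq_id (hC : IsCylinderCategory Cof W) (X : C) : W (𝟙 X) := hC.weq_of_isIso _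

lemma weq_leg₀ (hC : IsCylinderCategory Cof W) {A B : C} {i : A ⟶ B} (K : RelCylinder Cof W i) :
    W K.leg₀ :=
  hC.weq_of_postcomp _ K.proj K.weq_proj
    (by simpa [RelCylinder.leg₀, K.inl_incl_proj] using hC.weq_id B)

lemma cof_leg₀ (hC : IsCylinderCategory Cof W) {A B : C} {i : A ⟶ B} (hi : Cof i)
    (K : RelCylinder Cof W i) : Cof K.leg₀ :=
  hC.cof_comp _ _ (hC.cof_pushout K.isPushout.flip hi) K.cof_incl

lemma weq_leg₁ (hC : IsCylinderCategory Cof W) {A B : C} {i : A ⟶ B} (K : RelCylinder Cof W i) :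
    W K.leg₁ :=
  hC.weq_of_postcomp _ K.proj K.weq_proj
    (by simpa [RelCylinder.leg₁, K.inr_incl_proj] using hC.weq_id B)

lemma cof_leg₁ (hC : IsCylinderCategory Cof W) {A B : C} {i : A ⟶ B} (hi : Cof i)
    (K : RelCylinder Cof W i) : Cof K.leg₁ :=
  hC.cof_comp _ _ (hC.cof_pushout K.isPushout hi) K.cof_incl

lemma exists_isPushout (hC : IsCylinderCategory Cof W) {A B A' : C} (i : A ⟶ B) (f : A ⟶ A')
    (hi : Cof i) : ∃ (B' : C) (g : B ⟶ B') (i' : A' ⟶ B'), IsPushout i f g i' := by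
  have := hC.hasPushout i f hi
  exact ⟨_, _, _, IsPushout.of_hasPushout i f⟩

/-- The mapping cylinder factorization. -/
lemma exists_factorization (hC : IsCylinderCategory Cof W) {A B : C} (f : A ⟶ B) :
    ∃ (M : C) (j : A ⟶ M) (p : M ⟶ B), Cof j ∧ W p ∧ j ≫ p = f := by
  have := hC.hasInitial
  let hZ := initialIsInitial (C := C)
  obtain ⟨K⟩ := hC.exists_cylinder hZ A
  have h₀ (X : C) := hC.cof_from_initial hZ X
  -- `D` is the coproduct of `A` and `B`, and `M` glues the cylinder of `A` to `B` along `f` at its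
  -- second end. So `B ⟶ M` is a pushout of `K.leg₁`, hence a trivial cofibration, and `A ⟶ D` is a
  -- pushout of `0 ⟶ B`.
  obtain ⟨D, b, a, sq⟩ := hC.exists_isPushout K.inr f (hC.cof_pushout K.isPushout (h₀ A))
  obtain ⟨M, c, d, sq'⟩ := hC.exists_isPushout K.incl b K.cof_incl
  have sq₁ := sq.paste_horiz sq'
  have hs := hC.trivialCof_pushout sq₁ (hC.cof_leg₁ (h₀ A) K) (hC.weq_leg₁ K)
  have sq₂ := K.isPushout.paste_vert sq
  have hj : Cof (K.inl ≫ b) := hC.cof_pushout (f := hZ.to A) sq₂.flip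
    (by rw [hZ.hom_ext (hZ.to A ≫ f) (hZ.to B)]; exact h₀ B)
  have w : (K.inr ≫ K.incl) ≫ K.proj ≫ f = f ≫ 𝟙 B := by
    simpa using K.inr_incl_proj =≫ f
  refine ⟨M, K.inl ≫ b ≫ d, sq₁.desc (K.proj ≫ f) (𝟙 B) w, ?_, ?_, ?_⟩
  · rw [← Category.assoc]
    exact hC.cof_comp _ _ hj (hC.cof_pushout sq' K.cof_incl)
  · refine hC.weq_of_precomp (a ≫ d) _ hs.2 ?_
    rw [sq₁.inr_desc]
    exact hC.weq_id B
  · have : b ≫ d = K.incl ≫ c := sq'.w.symm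
    rw [this]
    simp only [Category.assoc, sq₁.inl_desc]
    simpa using K.inl_incl_proj =≫ f

/-- Only absolute cylinders are axiomatic; relative ones come from the mapping cylinder of the
codiagonal. -/
lemma nonempty_relCylinder (hC : IsCylinderCategory Cof W) {A B : C} (i : A ⟶ B) (hi : Cof i) :
    Nonempty (RelCylinder Cof W i) := by
  obtain ⟨D, a, b, sq⟩ := hC.exists_isPushout i i hi
  obtain ⟨M, j, p, hj, hp, w⟩ := hC.exists_factorization (sq.desc (𝟙 B) (𝟙 B) rfl)
  exact ⟨{  dbl := D, inl := a, inr := b, isPushout := sq, cyl := M, incl := j, proj := p,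
            cof_incl := hj, weq_proj := hp
            inl_incl_proj := by rw [w, sq.inl_desc]
            inr_incl_proj := by rw [w, sq.inr_desc] }⟩

/-- Any commutative square from a cofibration `j` to a weak equivalence `q` has a filler `w` for
which the upper triangle commutes; `w` factors through a trivial cofibration `t : E ⟶ Q` over `B`
and a retraction of `t`. -/
lemma exists_lift (hC : IsCylinderCategory Cof W) {D E E' B : C} {j : D ⟶ E'} {u : D ⟶ E}
    {q : E ⟶ B} {v : E' ⟶ B} (hj : Cof j) (hq : W q) (sq : j ≫ v = u ≫ q) :
    ∃ (Q : C) (t : E ⟶ Q) (e : E' ⟶ Q) (π : Q ⟶ B) (r : Q ⟶ E), Cof t ∧ W t ∧ j ≫ e = u ≫ t ∧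
      t ≫ r = 𝟙 E ∧ t ≫ π = q ∧ e ≫ π = v := by
  -- `Q` replaces the pushout of `j` along `u` by an object weakly equivalent to `B`. Then `E ⟶ Q`
  -- is a cofibration and, by cancellation over `B`, a weak equivalence, so it has a retraction.
  obtain ⟨P, a, b, hP⟩ := hC.exists_isPushout j u hj
  obtain ⟨Q, c, π, hc, hπ, w⟩ := hC.exists_factorization (hP.desc v q sq)
  have ht : Cof (b ≫ c) := hC.cof_comp _ _ (hC.cof_pushout hP hj) hc
  have htπ : (b ≫ c) ≫ π = q := by rw [Category.assoc, w, hP.inr_desc]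
  have ht' : W (b ≫ c) := hC.weq_of_postcomp _ π hπ (by rwa [htπ])
  obtain ⟨r, hr⟩ := hC.exists_retraction _ ht ht'
  exact ⟨Q, b ≫ c, a ≫ c, π, r, ht, ht', by simp [hP.w_assoc], hr, htπ,
    by rw [Category.assoc, w, hP.inl_desc]⟩

/-- `K.cyl` maps to any object equipped with two sections of a weak equivalence to `B'`. -/
lemma exists_cyl_map (hC : IsCylinderCategory Cof W) {A B B' G : C} {i : A ⟶ B}
    (K : RelCylinder Cof W i) (β : B ⟶ B') (g₀ g₁ : B ⟶ G) (q : G ⟶ B') (hq : W q)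
    (w : i ≫ g₀ = i ≫ g₁) (w₀ : g₀ ≫ q = β) (w₁ : g₁ ≫ q = β) :
    ∃ m : K.cyl ⟶ G, K.leg₀ ≫ m = g₀ ∧ K.leg₁ ≫ m = g₁ := by
  -- Lift the boundary inclusion of the cylinder against `q`; only the upper triangle matters, so
  -- the composite of `m` with `q` is left uncontrolled.
  obtain ⟨Q, t, e, π, r, -, -, h, hr, -, -⟩ := hC.exists_lift (j := K.incl)
    (u := K.isPushout.desc g₀ g₁ w) (q := q) (v := K.proj ≫ β) K.cof_incl hq (by
      apply K.isPushout.hom_ext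
      · rw [K.isPushout.inl_desc_assoc, w₀]
        simpa using K.inl_incl_proj =≫ β
      · rw [K.isPushout.inr_desc_assoc, w₁]
        simpa using K.inr_incl_proj =≫ β)
  refine ⟨e ≫ r, ?_, ?_⟩
  · simp [RelCylinder.leg₀, reassoc_of% h, hr]
  · simp [RelCylinder.leg₁, reassoc_of% h, hr]

end IsCylinderCategory

end CylinderCategory

/-! ### The completion as a category of local presheaves; finite presentability. -/

section Presentability

variable {C : Type u} [SmallCategory C]

/-- By Yoneda, the pullback condition becomes a unique extension property for maps out of
representables, the form in which it matches locality with respect to `CofPushout.comparison`. -/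
lemma isPullback_map_op_iff (F : Cᵒᵖ ⥤ Type u) {A B A' B' : C} {i : A ⟶ B} {f : A ⟶ A'}
    {g : B ⟶ B'} {i' : A' ⟶ B'} (w : i ≫ g = f ≫ i') :
    IsPullback (F.map g.op) (F.map i'.op) (F.map i.op) (F.map f.op) ↔
      (∀ c c' : yoneda.obj B' ⟶ F, yoneda.map g ≫ c = yoneda.map g ≫ c' →
        yoneda.map i' ≫ c = yoneda.map i' ≫ c' → c = c') ∧
      (∀ (a : yoneda.obj B ⟶ F) (b : yoneda.obj A' ⟶ F), yoneda.map i ≫ a = yoneda.map f ≫ b →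
        ∃ c : yoneda.obj B' ⟶ F, yoneda.map g ≫ c = a ∧ yoneda.map i' ≫ c = b) := by
  have key {X Y : C} (k : X ⟶ Y) (c : yoneda.obj Y ⟶ F) :
      F.map k.op (yonedaEquiv c) = yonedaEquiv (yoneda.map k ≫ c) := yonedaEquiv_naturality _ _
  rw [Types.isPullback_iff]
  constructor
  · rintro ⟨-, h₁, h₂⟩
    refine ⟨fun c c' h h' ↦ yonedaEquiv.injective (h₁ _ _ ?_), fun a b h ↦ ?_⟩
    · rw [key, key, key, key, h, h']
      exact ⟨rfl, rfl⟩
    · obtain ⟨x, hx, hx'⟩ := h₂ (yonedaEquiv a) (yonedaEquiv b) (by rw [key, key, h])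
      obtain ⟨c, rfl⟩ := yonedaEquiv.surjective x
      rw [key] at hx hx'
      exact ⟨c, yonedaEquiv.injective hx, yonedaEquiv.injective hx'⟩
  · rintro ⟨h₁, h₂⟩
    refine ⟨by rw [← F.map_comp, ← F.map_comp, ← op_comp, ← op_comp, w], ?_, ?_⟩
    · intro x y h
      obtain ⟨c, rfl⟩ := yonedaEquiv.surjective x
      obtain ⟨c', rfl⟩ := yonedaEquiv.surjective y
      rw [key, key, key, key] at h
      rw [h₁ c c' (yonedaEquiv.injective h.1) (yonedaEquiv.injective h.2)]
    · intro x y h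
      obtain ⟨a, rfl⟩ := yonedaEquiv.surjective x
      obtain ⟨b, rfl⟩ := yonedaEquiv.surjective y
      rw [key, key] at h
      obtain ⟨c, rfl, rfl⟩ := h₂ a b (yonedaEquiv.injective h)
      exact ⟨yonedaEquiv c, key _ _, key _ _⟩

lemma bijective_desc_comp_iff {E : Type*} [Category* E] {X₁ X₂ X₃ P X₄ F : E} {f : X₁ ⟶ X₂}
    {g : X₁ ⟶ X₃} {l : X₂ ⟶ P} {r : X₃ ⟶ P} (sq : IsPushout f g l r) {l' : X₂ ⟶ X₄} {r' : X₃ ⟶ X₄}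
    (w : f ≫ l' = g ≫ r') :
    Function.Bijective (fun c : X₄ ⟶ F ↦ sq.desc l' r' w ≫ c) ↔
      (∀ c c' : X₄ ⟶ F, l' ≫ c = l' ≫ c' → r' ≫ c = r' ≫ c' → c = c') ∧
      (∀ (a : X₂ ⟶ F) (b : X₃ ⟶ F), f ≫ a = g ≫ b → ∃ c : X₄ ⟶ F, l' ≫ c = a ∧ r' ≫ c = b) := by
  constructor
  · rintro ⟨h₁, h₂⟩
    refine ⟨fun c c' h h' ↦ h₁ (sq.hom_ext ?_ ?_), fun a b h ↦ ?_⟩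
    · simpa using h
    · simpa using h'
    · obtain ⟨c, hc⟩ := h₂ (sq.desc a b h)
      refine ⟨c, ?_, ?_⟩
      · simpa using l ≫= hc
      · simpa using r ≫= hc
  · rintro ⟨h₁, h₂⟩
    refine ⟨fun c c' h ↦ h₁ _ _ ?_ ?_, fun d ↦ ?_⟩
    · simpa using l ≫= h
    · simpa using r ≫= h
    · obtain ⟨c, hc, hc'⟩ := h₂ (l ≫ d) (r ≫ d) (by rw [sq.w_assoc])
      exact ⟨c, sq.hom_ext (by simpa using hc) (by simpa using hc')⟩

variable (Cof : MorphismProperty C)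

/-- The pushout squares along cofibrations. -/
structure CofPushout where
  {A B A' B' : C}
  {i : A ⟶ B}
  {f : A ⟶ A'}
  {g : B ⟶ B'}
  {i' : A' ⟶ B'}
  cof : Cof i
  sq : IsPushout i f g i'

/-- The comparison map from the pushout of representable presheaves to the presheaf represented by
the pushout. -/
noncomputable def CofPushout.comparison {Cof : MorphismProperty C} (s : CofPushout Cof) :
    pushout (yoneda.map s.i) (yoneda.map s.f) ⟶ yoneda.obj s.B' :=
  (IsPushout.of_hasPushout (yoneda.map s.i) (yoneda.map s.f)).desc (yoneda.map s.g)
    (yoneda.map s.i') (by rw [← Functor.map_comp, ← Functor.map_comp, s.sq.w])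

/-- The maps of presheaves whose local objects are the objects of the completion. -/
noncomputable def localizer : MorphismProperty (Cᵒᵖ ⥤ Type u) :=
  MorphismProperty.ofHoms (fun Z : { Z : C // Nonempty (IsInitial Z) } ↦
    initial.to (yoneda.obj Z.1)) ⊔
  MorphismProperty.ofHoms (fun s : CofPushout Cof ↦ s.comparison)

instance : Small.{u} (CofPushout Cof) := by
  let φ (s : CofPushout Cof) : Σ (A B A' B' : C), (A ⟶ B) × (A ⟶ A') × (B ⟶ B') × (A' ⟶ B') :=
    ⟨s.A, s.B, s.A', s.B', s.i, s.f, s.g, s.i'⟩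
  have : Function.Injective φ := by
    rintro ⟨_, _⟩ ⟨_, _⟩ h
    simp only [φ, Sigma.mk.injEq] at h
    obtain ⟨rfl, h⟩ := h
    simp only [heq_eq_eq, Sigma.mk.injEq] at h
    obtain ⟨rfl, h⟩ := h
    simp only [heq_eq_eq, Sigma.mk.injEq] at h
    obtain ⟨rfl, h⟩ := h
    simp only [heq_eq_eq, Sigma.mk.injEq] at h
    obtain ⟨rfl, h⟩ := h
    simp only [heq_eq_eq, Prod.mk.injEq] at h
    obtain ⟨rfl, rfl, rfl, rfl⟩ := h
    rfl
  exact small_of_injective this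

instance : MorphismProperty.IsSmall.{u} (localizer Cof) := by
  refine ⟨?_⟩
  have : Small.{u} ((MorphismProperty.ofHoms
      (fun Z : { Z : C // Nonempty (IsInitial Z) } ↦ initial.to (yoneda.obj Z.1))).toSet ∪
      (MorphismProperty.ofHoms (fun s : CofPushout Cof ↦ s.comparison)).toSet :
        Set (Arrow (Cᵒᵖ ⥤ Type u))) := inferInstance
  exact this

lemma isModel_eq_isLocal : isModel Cof = (localizer Cof).isLocal := by
  ext F
  constructor
  · rintro ⟨h₁, h₂⟩ X Y _ (hf | hf)
    · obtain ⟨Z, ⟨hZ⟩⟩ := hf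
      obtain ⟨_⟩ := h₁ hZ
      exact ⟨fun c c' _ ↦ yonedaEquiv.injective (Subsingleton.elim _ _),
        fun d ↦ ⟨yonedaEquiv.symm default, initialIsInitial.hom_ext _ _⟩⟩
    · obtain ⟨s⟩ := hf
      exact (bijective_desc_comp_iff _ _).2
        ((isPullback_map_op_iff F s.sq.w).1 (h₂ s.cof s.sq))
  · intro h
    refine ⟨fun Z hZ ↦ ?_, fun A B A' B' i f g i' hi sq ↦ ?_⟩
    · have := h _ (Or.inl ⟨⟨Z, ⟨hZ⟩⟩⟩)
      obtain ⟨c, hc⟩ := this.2 (initial.to F)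
      exact ⟨⟨⟨yonedaEquiv c⟩, fun x ↦ by
        obtain ⟨c', rfl⟩ := yonedaEquiv.surjective x
        exact congrArg yonedaEquiv (this.1 (initialIsInitial.hom_ext _ _))⟩⟩
    · have := h _ (Or.inr ⟨(⟨hi, sq⟩ : CofPushout Cof)⟩)
      exact (isPullback_map_op_iff F sq.w).2 ((bijective_desc_comp_iff _ _).1 this)

attribute [local instance] Cardinal.fact_isRegular_aleph0

instance isFinitelyPresentable_yoneda (X : C) :
    IsFinitelyPresentable.{u} (yoneda.obj X) := by
  have e : uliftYoneda.{u}.obj X ≅ yoneda.obj X :=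
    NatIso.ofComponents (fun _ ↦ Equiv.ulift.toIso) (by intros; rfl)
  exact isCardinalPresentable_of_iso e _

/-- Sources and targets are finite colimits of representables. Hence the local objects form a
locally finitely presentable category whose inclusion into presheaves preserves filtered colimits.
-/
lemma isFinitelyPresentable_of_localizer ⦃X Y : Cᵒᵖ ⥤ Type u⦄ (f : X ⟶ Y) (hf : localizer Cof f) :
    IsFinitelyPresentable.{u} X ∧ IsFinitelyPresentable.{u} Y := by
  have h (J : Type) [SmallCategory J] [FinCategory J] (F : J ⥤ Cᵒᵖ ⥤ Type u)
      (hF : ∀ j, IsFinitelyPresentable.{u} (F.obj j)) : IsFinitelyPresentable.{u} (colimit F) :=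
    isCardinalPresentable_of_isColimit _ (colimit.isColimit F) _
      (by rw [hasCardinalLT_aleph0_iff]; infer_instance)
  obtain hf | hf := hf
  · obtain ⟨Z, hZ⟩ := hf
    exact ⟨h _ _ (by rintro ⟨⟨⟩⟩), inferInstance⟩
  · obtain ⟨s⟩ := hf
    refine ⟨h _ _ ?_, inferInstance⟩
    rintro (_ | _ | _) <;> dsimp <;> infer_instance

instance : IsCardinalLocallyPresentable.{u} (Completion Cof) Cardinal.aleph0.{u} := by
  have := (localizer Cof).isLocallyPresentable_isLocal Cardinal.aleph0.{u}
    (isFinitelyPresentable_of_localizer Cof)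
  rwa [← isModel_eq_isLocal] at this

instance : HasLimits (Completion Cof) := by
  have : HasLimits (localizer Cof).isLocal.FullSubcategory :=
    { has_limits_of_shape := inferInstance }
  rwa [← isModel_eq_isLocal] at this

instance : HasColimits (Completion Cof) := inferInstance

instance : (isModel Cof).ι.IsCardinalAccessible Cardinal.aleph0.{u} := by
  have := (localizer Cof).isCardinalAccessible_ι_isLocal Cardinal.aleph0.{u}
    (isFinitelyPresentable_of_localizer Cof)
  rwa [← isModel_eq_isLocal] at this

instance isFinitelyPresentable_y (X : C) : IsFinitelyPresentable.{u} ((y Cof).obj X) := by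
  let e : (isModel Cof).ι ⋙ coyoneda.obj (op (yoneda.obj X)) ≅
      coyoneda.obj (op ((y Cof).obj X)) :=
    NatIso.ofComponents
      (fun F ↦ ((isModel Cof).fullyFaithfulι.homEquiv (X := (y Cof).obj X)).symm.toIso)
      (by intros; rfl)
  exact Functor.isCardinalAccessible_of_natIso e _

end Presentability

/-! ### The Yoneda embedding and the small object argument. -/

section Completion

variable {C : Type u} [SmallCategory C] {Cof W : MorphismProperty C}

instance : (y Cof).Full := inferInstanceAs ((isModel Cof).lift yoneda (isModel_yoneda Cof)).Full

instance : (y Cof).Faithful :=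
  inferInstanceAs ((isModel Cof).lift yoneda (isModel_yoneda Cof)).Faithful

/-- Objects of the completion send the square to a pullback, which by Yoneda is the universal
property of a pushout tested on them. -/
lemma isPushout_y {A B A' B' : C} {i : A ⟶ B} {f : A ⟶ A'} {g : B ⟶ B'} {i' : A' ⟶ B'}
    (sq : IsPushout i f g i') (hi : Cof i) :
    IsPushout ((y Cof).map i) ((y Cof).map f) ((y Cof).map g) ((y Cof).map i') where
  w := by rw [← Functor.map_comp, sq.w, Functor.map_comp]
  isColimit' := ⟨by
    have h (X : Completion Cof) := (isPullback_map_op_iff X.obj sq.w).1 (X.property.2 hi sq)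
    have h' (s : PushoutCocone ((y Cof).map i) ((y Cof).map f)) :
        ∃ d : (y Cof).obj B' ⟶ s.pt, (y Cof).map g ≫ d = s.inl ∧ (y Cof).map i' ≫ d = s.inr := by
      obtain ⟨c, hc, hc'⟩ := (h s.pt).2 s.inl.hom s.inr.hom
        (congrArg InducedCategory.Hom.hom s.condition)
      exact ⟨ObjectProperty.homMk c, InducedCategory.hom_ext hc, InducedCategory.hom_ext hc'⟩
    choose d hd hd' using h'
    refine PushoutCocone.IsColimit.mk _ d hd hd' (fun s m hm hm' ↦ InducedCategory.hom_ext
      ((h s.pt).1 _ _ ?_ ?_))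
    · exact congrArg InducedCategory.Hom.hom (hm.trans (hd s).symm)
    · exact congrArg InducedCategory.Hom.hom (hm'.trans (hd' s).symm)⟩

lemma nonempty_isInitial_y {Z : C} (hZ : IsInitial Z) : Nonempty (IsInitial ((y Cof).obj Z)) := by
  have h (X : Completion Cof) : Nonempty (Unique ((y Cof).obj Z ⟶ X)) := by
    obtain ⟨_⟩ := X.property.1 hZ
    have e : ((y Cof).obj Z ⟶ X) ≃ X.obj.obj (op Z) :=
      ((isModel Cof).fullyFaithfulι.homEquiv (X := (y Cof).obj Z)).trans yonedaEquiv
    exact ⟨e.unique⟩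
  have (X : Completion Cof) := (h X).some
  exact ⟨IsInitial.ofUnique _⟩

lemma genCof_map {A B : C} {i : A ⟶ B} (hi : Cof i) : genCof Cof ((y Cof).map i) := ⟨hi⟩

lemma genTrivCof_map {A B : C} {i : A ⟶ B} (hi : Cof i) (hi' : W i) :
    genTrivCof Cof W ((y Cof).map i) := ⟨⟨hi, hi'⟩⟩

lemma genTrivCof_le : genTrivCof Cof W ≤ genCof Cof :=
  MorphismProperty.monotone_strictMap _ inf_le_left

lemma isSmall_strictMap_y (P : MorphismProperty C) :
    MorphismProperty.IsSmall.{u} (P.strictMap (y Cof)) := by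
  have : P.strictMap (y Cof) =
      .ofHoms (fun f : P.toSet ↦ (y Cof).map f.1.hom) := by
    ext X Y f
    exact ⟨fun ⟨hf⟩ ↦ ⟨(⟨Arrow.mk _, hf⟩ : P.toSet)⟩, fun ⟨f⟩ ↦ ⟨f.2⟩⟩
  rw [this]
  have : Small.{u} (Arrow C) := by
    let φ (f : Arrow C) : Σ (A B : C), A ⟶ B := ⟨f.left, f.right, f.hom⟩
    refine small_of_injective (f := φ) ?_
    rintro ⟨_, _, _⟩ ⟨_, _, _⟩ h
    simp only [φ, Sigma.mk.injEq] at h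
    obtain ⟨h₁, h⟩ := h
    cases h₁
    simp only [heq_eq_eq, Sigma.mk.injEq] at h
    obtain ⟨h₁, h⟩ := h
    cases h₁
    cases h
    rfl
  infer_instance

attribute [local instance] Cardinal.fact_isRegular_aleph0 Cardinal.orderBotAleph0OrdToType

lemma hasSmallObjectArgument_strictMap_y (P : MorphismProperty C) :
    MorphismProperty.HasSmallObjectArgument.{u} (P.strictMap (y Cof)) := by
  have := isSmall_strictMap_y (Cof := Cof) P
  have : MorphismProperty.IsCardinalForSmallObjectArgument.{u} (P.strictMap (y Cof))
      Cardinal.aleph0.{u} :=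
    { preservesColimit := by
        rintro _ _ _ _ _ ⟨hi⟩ f hf
        infer_instance }
  exact ⟨Cardinal.aleph0.{u}, inferInstance, inferInstance, this⟩

instance : MorphismProperty.HasSmallObjectArgument.{u} (genCof Cof) :=
  hasSmallObjectArgument_strictMap_y _

instance : MorphismProperty.HasSmallObjectArgument.{u} (genTrivCof Cof W) :=
  hasSmallObjectArgument_strictMap_y _

/-- The small object argument applies at `ℵ₀`, since representables are finitely presentable. -/
lemma cof_eq_llp_rlp : cof Cof = (genCof Cof).rlp.llp :=
  (genCof Cof).llp_rlp_of_hasSmallObjectArgument.symm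

lemma rlp_genCof_le_fib : (genCof Cof).rlp ≤ fib Cof W :=
  MorphismProperty.antitone_rlp genTrivCof_le

lemma llp_fib_le_cof : (fib Cof W).llp ≤ cof Cof := by
  rw [cof_eq_llp_rlp]
  exact MorphismProperty.antitone_llp rlp_genCof_le_fib

end Completion

/-! ### Calculus of relative homotopies and the factorization criterion. -/

section Homotopy

variable {C : Type u} [SmallCategory C] {Cof W : MorphismProperty C}

/-- Homotopy relative to `i : A ⟶ B` of two maps from `B` to an object of the completion. -/
def Htpy (W : MorphismProperty C) {A B : C} (i : A ⟶ B) {X : Completion Cof}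
    (a b : (y Cof).obj B ⟶ X) : Prop :=
  ∃ (K : RelCylinder Cof W i) (h : (y Cof).obj K.cyl ⟶ X),
    (y Cof).map K.leg₀ ≫ h = a ∧ (y Cof).map K.leg₁ ≫ h = b

namespace Htpy

variable {A B : C} {i : A ⟶ B} {X Y : Completion Cof} {a b c : (y Cof).obj B ⟶ X}

lemma comp (h : Htpy W i a b) (f : X ⟶ Y) : Htpy W i (a ≫ f) (b ≫ f) := by
  obtain ⟨K, h, rfl, rfl⟩ := h
  exact ⟨K, h ≫ f, by simp, by simp⟩

/-- A homotopy can be given by any object with two sections of a weak equivalence to `B'`. -/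
lemma mk (hC : IsCylinderCategory Cof W) (hi : Cof i) {B' G : C} (β : B ⟶ B') (g₀ g₁ : B ⟶ G)
    (q : G ⟶ B') (hq : W q) (w : i ≫ g₀ = i ≫ g₁) (w₀ : g₀ ≫ q = β) (w₁ : g₁ ≫ q = β)
    (h : (y Cof).obj G ⟶ X) : Htpy W i ((y Cof).map g₀ ≫ h) ((y Cof).map g₁ ≫ h) := by
  obtain ⟨K⟩ := hC.nonempty_relCylinder i hi
  obtain ⟨m, rfl, rfl⟩ := hC.exists_cyl_map K β g₀ g₁ q hq w w₀ w₁
  exact ⟨K, (y Cof).map m ≫ h, by simp, by simp⟩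

lemma refl (hC : IsCylinderCategory Cof W) (hi : Cof i) (a : (y Cof).obj B ⟶ X) :
    Htpy W i a a := by
  simpa using mk hC hi (𝟙 B) (𝟙 B) (𝟙 B) (𝟙 B) (hC.weq_id B) rfl (by simp) (by simp) a

lemma symm (hC : IsCylinderCategory Cof W) (hi : Cof i) (h : Htpy W i a b) : Htpy W i b a := by
  obtain ⟨K, h, rfl, rfl⟩ := h
  exact mk hC hi (𝟙 B) K.leg₁ K.leg₀ K.proj K.weq_proj
    (by simp [RelCylinder.leg₀, RelCylinder.leg₁, K.isPushout.w_assoc])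
    (by simp [RelCylinder.leg₁, K.inr_incl_proj]) (by simp [RelCylinder.leg₀, K.inl_incl_proj]) h

lemma trans (hC : IsCylinderCategory Cof W) (hi : Cof i) (h : Htpy W i a b) (h' : Htpy W i b c) :
    Htpy W i a c := by
  obtain ⟨K, h, rfl, rfl⟩ := h
  obtain ⟨K', h', hb, rfl⟩ := h'
  -- Glue the two cylinders end to end. `G` need not be a relative cylinder, but it is weakly
  -- equivalent to `B`, which is all that `mk` needs.
  obtain ⟨G, g', g, sq⟩ := hC.exists_isPushout K'.leg₀ K.leg₁ (hC.cof_leg₀ hi K')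
  have hg := hC.trivialCof_pushout sq (hC.cof_leg₀ hi K') (hC.weq_leg₀ K')
  have w : K'.leg₀ ≫ K'.proj = K.leg₁ ≫ K.proj := by
    simp [RelCylinder.leg₀, RelCylinder.leg₁, K.inr_incl_proj, K'.inl_incl_proj]
  have sq' := isPushout_y sq (hC.cof_leg₀ hi K')
  have := mk hC hi (𝟙 B) (K.leg₀ ≫ g) (K'.leg₁ ≫ g') (sq.desc K'.proj K.proj w)
    (hC.weq_of_precomp g _ hg.2 (by rw [sq.inr_desc]; exact K.weq_proj)) (by
      have e : i ≫ K.leg₀ = i ≫ K.leg₁ := by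
        simp [RelCylinder.leg₀, RelCylinder.leg₁, K.isPushout.w_assoc]
      have e' : i ≫ K'.leg₀ = i ≫ K'.leg₁ := by
        simp [RelCylinder.leg₀, RelCylinder.leg₁, K'.isPushout.w_assoc]
      rw [reassoc_of% e, ← reassoc_of% e', sq.w])
    (by simp [RelCylinder.leg₀, K.inl_incl_proj]) (by simp [RelCylinder.leg₁, K'.inr_incl_proj])
    (sq'.desc h' h hb)
  simpa using this

/-- Two maps which agree on the domain of a trivial cofibration are homotopic. -/
lemma of_trivialCof (hC : IsCylinderCategory Cof W) (hi : Cof i) (hi' : W i)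
    (w : (y Cof).map i ≫ a = (y Cof).map i ≫ b) : Htpy W i a b := by
  obtain ⟨K⟩ := hC.nonempty_relCylinder i hi
  have hl := hC.trivialCof_pushout K.isPushout hi hi'
  -- Both `K.inr` and `K.leg₁` are weak equivalences, so the boundary inclusion is a trivial
  -- cofibration; its retraction extends `(a, b)` over the cylinder.
  obtain ⟨ρ, hρ⟩ := hC.exists_retraction K.incl K.cof_incl
    (hC.weq_of_precomp K.inr _ hl.2 (hC.weq_leg₁ K))
  refine ⟨K, (y Cof).map ρ ≫ (isPushout_y K.isPushout hi).desc a b w, ?_, ?_⟩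
  · rw [← Functor.map_comp_assoc, RelCylinder.leg₀, Category.assoc, hρ, Category.comp_id,
      IsPushout.inl_desc]
  · rw [← Functor.map_comp_assoc, RelCylinder.leg₁, Category.assoc, hρ, Category.comp_id,
      IsPushout.inr_desc]

/-- Restriction of homotopies along a commutative square. -/
lemma precomp (hC : IsCylinderCategory Cof W) (h : Htpy W i a b) {A' B' : C} {i' : A' ⟶ B'}
    (hi' : Cof i') (α : A' ⟶ A) (β : B' ⟶ B) (w : i' ≫ β = α ≫ i) :
    Htpy W i' ((y Cof).map β ≫ a) ((y Cof).map β ≫ b) := by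
  obtain ⟨K, h, rfl, rfl⟩ := h
  simpa using mk hC hi' β (β ≫ K.leg₀) (β ≫ K.leg₁) K.proj K.weq_proj
    (by simp [RelCylinder.leg₀, RelCylinder.leg₁, reassoc_of% w, K.isPushout.w_assoc])
    (by simp [RelCylinder.leg₀, K.inl_incl_proj]) (by simp [RelCylinder.leg₁, K.inr_incl_proj]) h

end Htpy

lemma equivalence_relHomotopic (hC : IsCylinderCategory Cof W) {A B : C} (i : A ⟶ B) (hi : Cof i)
    {X : Completion Cof} (x : (y Cof).obj A ⟶ X) : Equivalence (RelHomotopic W i x) where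
  refl a := Htpy.refl hC hi a.1
  symm h := Htpy.symm hC hi h
  trans h h' := Htpy.trans hC hi h h'

lemma weq.exists_lift {X Y : Completion Cof} {f : X ⟶ Y} (hf : weq Cof W f) {A B : C} {i : A ⟶ B}
    (hi : Cof i) (s : (y Cof).obj A ⟶ X) (t : (y Cof).obj B ⟶ Y)
    (w : s ≫ f = (y Cof).map i ≫ t) :
    ∃ a : (y Cof).obj B ⟶ X, (y Cof).map i ≫ a = s ∧ Htpy W i (a ≫ f) t := by
  obtain ⟨K, a, h, ha, h₀, h₁⟩ := hf i hi s t w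
  exact ⟨a, ha, K, h, h₀, h₁⟩

lemma weq_iff {X Y : Completion Cof} (f : X ⟶ Y) :
    weq Cof W f ↔ ∀ ⦃A B : C⦄ (i : A ⟶ B), Cof i →
      ∀ (s : (y Cof).obj A ⟶ X) (t : (y Cof).obj B ⟶ Y), s ≫ f = (y Cof).map i ≫ t →
        ∃ a : (y Cof).obj B ⟶ X, (y Cof).map i ≫ a = s ∧ Htpy W i (a ≫ f) t :=
  ⟨fun hf _ _ _ hi s t w ↦ hf.exists_lift hi s t w, fun h _ _ i hi s t w ↦ by
    obtain ⟨a, ha, K, h, h₀, h₁⟩ := h i hi s t w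
    exact ⟨K, a, h, ha, h₀, h₁⟩⟩

/-- The square `(s, t)` from `i` to `f` factors through a map of `C` in the class `P`. -/
def FactorsThrough (P : MorphismProperty C) {A B : C} (i : A ⟶ B) {X Y : Completion Cof}
    (f : X ⟶ Y) (s : (y Cof).obj A ⟶ X) (t : (y Cof).obj B ⟶ Y) : Prop :=
  ∃ (A' B' : C) (j : A' ⟶ B') (α : A ⟶ A') (β : B ⟶ B') (s' : (y Cof).obj A' ⟶ X)
    (t' : (y Cof).obj B' ⟶ Y), P j ∧ i ≫ β = α ≫ j ∧ s' ≫ f = (y Cof).map j ≫ t' ∧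
      (y Cof).map α ≫ s' = s ∧ (y Cof).map β ≫ t' = t

/-- The homotopy is itself the factorization: `i` and `K.leg₁` form a square from `i` to the trivial
cofibration `K.leg₀`, and `(a, h)` is a square from the latter to `f`. -/
lemma weq.factorsThrough (hC : IsCylinderCategory Cof W) {X Y : Completion Cof} {f : X ⟶ Y}
    (hf : weq Cof W f) {A B : C} {i : A ⟶ B} (hi : Cof i) (s : (y Cof).obj A ⟶ X)
    (t : (y Cof).obj B ⟶ Y) (w : s ≫ f = (y Cof).map i ≫ t) :
    FactorsThrough (Cof ⊓ W) i f s t := by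
  obtain ⟨K, a, h, ha, h₀, h₁⟩ := hf i hi s t w
  exact ⟨_, _, K.leg₀, i, K.leg₁, a, h, ⟨hC.cof_leg₀ hi K, hC.weq_leg₀ K⟩,
    by simp [RelCylinder.leg₀, RelCylinder.leg₁, K.isPushout.w_assoc], h₀.symm, ha, h₁⟩

/-- A map is a weak equivalence as soon as all squares from a cofibration of `C` to it factor
through a weak equivalence of `C`. -/
lemma weq_of_factorsThrough (hC : IsCylinderCategory Cof W) {X Y : Completion Cof} {f : X ⟶ Y}
    (h : ∀ ⦃A B : C⦄ (i : A ⟶ B), Cof i → ∀ (s : (y Cof).obj A ⟶ X) (t : (y Cof).obj B ⟶ Y),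
      s ≫ f = (y Cof).map i ≫ t → FactorsThrough W i f s t) : weq Cof W f := by
  rw [weq_iff]
  intro A B i hi s t w
  obtain ⟨A', B', j, α, β, s', t', hj, w₁, w₂, rfl, rfl⟩ := h i hi s t w
  obtain ⟨Q, t, e, π, r, ht, ht', h₁, h₂, h₃, h₄⟩ := hC.exists_lift hi hj w₁
  refine ⟨(y Cof).map (e ≫ r) ≫ s', ?_, ?_⟩
  · rw [← Functor.map_comp_assoc, reassoc_of% h₁, h₂, Category.comp_id]
  -- On `B`, the two maps to compare are restrictions along `e` of `r ≫ j` and `π` followed by `t'`.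
  -- These agree on the domain of the trivial cofibration `t`.
  · have : Htpy W t ((y Cof).map (r ≫ j) ≫ t') ((y Cof).map π ≫ t') :=
      Htpy.of_trivialCof hC ht ht' (by
        rw [← Functor.map_comp_assoc, ← Functor.map_comp_assoc, reassoc_of% h₂, h₃])
    have h₅ := this.precomp hC hi α e h₁
    rw [← Functor.map_comp_assoc, ← Functor.map_comp_assoc, h₄] at h₅
    simpa [w₂] using h₅

end Homotopy

/-! ### Closure properties of weak equivalences, trivial fibrations, relative homotopy sets. -/

section WeakEquivalences

variable {C : Type u} [SmallCategory C] {Cof W : MorphismProperty C}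

lemma FactorsThrough.comp_right {P : MorphismProperty C} {A B : C} {i : A ⟶ B}
    {X Y X' Y' : Completion Cof} {f : X ⟶ Y} {f' : X' ⟶ Y'} {s : (y Cof).obj A ⟶ X}
    {t : (y Cof).obj B ⟶ Y} (h : FactorsThrough P i f s t) (a : X ⟶ X') (b : Y ⟶ Y')
    (w : a ≫ f' = f ≫ b) : FactorsThrough P i f' (s ≫ a) (t ≫ b) := by
  obtain ⟨A', B', j, α, β, s', t', hj, w₁, w₂, rfl, rfl⟩ := h
  exact ⟨A', B', j, α, β, s' ≫ a, t' ≫ b, hj, w₁, by simp [w, reassoc_of% w₂], by simp, by simp⟩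

lemma FactorsThrough.mono {P P' : MorphismProperty C} (hP : P ≤ P') {A B : C} {i : A ⟶ B}
    {X Y : Completion Cof} {f : X ⟶ Y} {s : (y Cof).obj A ⟶ X} {t : (y Cof).obj B ⟶ Y}
    (h : FactorsThrough P i f s t) : FactorsThrough P' i f s t := by
  obtain ⟨A', B', j, α, β, s', t', hj, h⟩ := h
  exact ⟨A', B', j, α, β, s', t', hP _ hj, h⟩

lemma weq_iff_factorsThrough (hC : IsCylinderCategory Cof W) {X Y : Completion Cof} (f : X ⟶ Y) :
    weq Cof W f ↔ ∀ ⦃A B : C⦄ (i : A ⟶ B), Cof i → ∀ (s : (y Cof).obj A ⟶ X)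
      (t : (y Cof).obj B ⟶ Y), s ≫ f = (y Cof).map i ≫ t → FactorsThrough W i f s t :=
  ⟨fun hf _ _ _ hi s t w ↦ (hf.factorsThrough hC hi s t w).mono inf_le_right,
    weq_of_factorsThrough hC⟩

namespace weq

variable {X Y Z : Completion Cof} {f : X ⟶ Y} {g : Y ⟶ Z}

lemma comp (hC : IsCylinderCategory Cof W) (hf : weq Cof W f) (hg : weq Cof W g) :
    weq Cof W (f ≫ g) := by
  rw [weq_iff]
  intro A B i hi s t w
  obtain ⟨b, hb, h⟩ := hg.exists_lift hi (s ≫ f) t (by simpa using w)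
  obtain ⟨a, ha, h'⟩ := hf.exists_lift hi s b hb.symm
  exact ⟨a, ha, by simpa using (h'.comp g).trans hC hi h⟩

/-- Injectivity up to homotopy is the lifting property of `f` against the boundary inclusion of a
cylinder. -/
lemma htpy_of_comp (hf : weq Cof W f) {A B : C} {i : A ⟶ B} (hi : Cof i)
    {a b : (y Cof).obj B ⟶ X} (w : (y Cof).map i ≫ a = (y Cof).map i ≫ b)
    (h : Htpy W i (a ≫ f) (b ≫ f)) : Htpy W i a b := by
  obtain ⟨K, h, h₀, h₁⟩ := h
  have sq := isPushout_y K.isPushout hi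
  obtain ⟨H, hH, -⟩ := hf.exists_lift K.cof_incl (sq.desc a b w) h (by
    apply sq.hom_ext
    · simpa [RelCylinder.leg₀] using h₀.symm
    · simpa [RelCylinder.leg₁] using h₁.symm)
  exact ⟨K, H, by simp [RelCylinder.leg₀, hH], by simp [RelCylinder.leg₁, hH]⟩

lemma of_comp_right (hg : weq Cof W g) (hfg : weq Cof W (f ≫ g)) : weq Cof W f := by
  rw [weq_iff]
  intro A B i hi s t w
  obtain ⟨a, ha, h⟩ := hfg.exists_lift hi s (t ≫ g) (by rw [reassoc_of% w])
  exact ⟨a, ha, hg.htpy_of_comp hi (by rw [reassoc_of% ha, w]) (by simpa using h)⟩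

/-- The map `s` lands in `Y`, while the hypothesis on `f ≫ g` needs data in `X`. So `s` is first
factored through a trivial cofibration `w₀` of `C` whose domain maps to `X`. -/
lemma of_comp_left (hC : IsCylinderCategory Cof W) (hf : weq Cof W f) (hfg : weq Cof W (f ≫ g)) :
    weq Cof W g := by
  refine weq_of_factorsThrough hC fun A B i hi s t w ↦ ?_
  have := hC.hasInitial
  let hZ := initialIsInitial (C := C)
  let hyZ := (nonempty_isInitial_y (Cof := Cof) hZ).some
  obtain ⟨A₀, A₁, w₀, -, α₁, s₀, s₁, hw₀, -, hs₀, -, rfl⟩ :=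
    hf.factorsThrough hC (hC.cof_from_initial hZ A) (hyZ.to X) s (hyZ.hom_ext _ _)
  obtain ⟨B₁, k, i₁, sq₁⟩ := hC.exists_isPushout i α₁ hi
  have hi₁ := hC.cof_pushout sq₁ hi
  have sq₁' := isPushout_y sq₁ hi
  obtain ⟨t₁, rfl, ht₁⟩ : ∃ t₁ : (y Cof).obj B₁ ⟶ Z, (y Cof).map k ≫ t₁ = t ∧
      (y Cof).map i₁ ≫ t₁ = s₁ ≫ g :=
    ⟨sq₁'.desc t (s₁ ≫ g) (by simpa using w.symm), by simp, by simp⟩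
  obtain ⟨A₂, B₂, w₂, α₂, β₂, s₂, t₂, hw₂, e₂, hs₂, rfl, rfl⟩ :=
    hfg.factorsThrough hC (hC.cof_comp _ _ hw₀.1 hi₁) s₀ t₁ (by
      rw [reassoc_of% hs₀, Functor.map_comp_assoc, ht₁])
  -- Pushing out `w₀` along `α₂` restores a domain mapping to `Y`; the induced map to `B₂` is a weak
  -- equivalence because `w₃` and `w₂` are.
  obtain ⟨A₃, γ, w₃, sq₃⟩ := hC.exists_isPushout w₀ α₂ hw₀.1
  have hw₃ := hC.trivialCof_pushout sq₃ hw₀.1 hw₀.2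
  have sq₃' := isPushout_y sq₃ hw₀.1
  obtain ⟨s₃, rfl, hs₃⟩ : ∃ s₃ : (y Cof).obj A₃ ⟶ Y, (y Cof).map γ ≫ s₃ = s₁ ∧
      (y Cof).map w₃ ≫ s₃ = s₂ ≫ f :=
    ⟨sq₃'.desc s₁ (s₂ ≫ f) (by simpa using hs₀.symm), by simp, by simp⟩
  have e₄ : w₀ ≫ i₁ ≫ β₂ = α₂ ≫ w₂ := by simpa using e₂
  refine ⟨A₃, B₂, sq₃.desc (i₁ ≫ β₂) w₂ e₄, α₁ ≫ γ, k ≫ β₂, s₃, t₂,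
    hC.weq_of_precomp w₃ _ hw₃.2 (by simpa using hw₂.2), ?_, ?_, by simp, by simp⟩
  · simp [sq₁.w_assoc]
  · apply sq₃'.hom_ext
    · rw [← Functor.map_comp_assoc, sq₃.inl_desc]
      simpa using ht₁.symm
    · rw [← Functor.map_comp_assoc, sq₃.inr_desc, reassoc_of% hs₃]
      simpa using hs₂

end weq

lemma weq_of_rlp_genCof (hC : IsCylinderCategory Cof W) {X Y : Completion Cof} {f : X ⟶ Y}
    (hf : (genCof Cof).rlp f) : weq Cof W f := by
  rw [weq_iff]
  intro A B i hi s t w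
  have := hf _ (genCof_map hi)
  have sq : CommSq s ((y Cof).map i) f t := ⟨w⟩
  exact ⟨sq.lift, sq.fac_left, by rw [sq.fac_right]; exact Htpy.refl hC hi t⟩

lemma fib_and_weq_iff (hC : IsCylinderCategory Cof W) {X Y : Completion Cof} (f : X ⟶ Y) :
    fib Cof W f ∧ weq Cof W f ↔ (genCof Cof).rlp f := by
  refine ⟨?_, fun h ↦ ⟨rlp_genCof_le_fib _ h, weq_of_rlp_genCof hC h⟩⟩
  rintro ⟨hf, hf'⟩ _ _ _ ⟨hi⟩
  refine ⟨fun {s t} sq ↦ ?_⟩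
  obtain ⟨A', B', j, α, β, s', t', hj, w₁, w₂, rfl, rfl⟩ := hf'.factorsThrough hC hi s t sq.w
  have := hf _ (genTrivCof_map hj.1 hj.2)
  have sq' : CommSq s' ((y Cof).map j) f t' := ⟨w₂⟩
  exact ⟨⟨{ l := (y Cof).map β ≫ sq'.lift
            fac_left := by
              rw [← Functor.map_comp_assoc, w₁, Functor.map_comp_assoc, sq'.fac_left]
            fac_right := by rw [Category.assoc, sq'.fac_right] }⟩⟩

lemma weq_isMultiplicative (hC : IsCylinderCategory Cof W) : (weq Cof W).IsMultiplicative where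
  id_mem _ := weq_of_rlp_genCof hC (MorphismProperty.rlp_of_isIso _ _)
  comp_mem _ _ hf hg := hf.comp hC hg

lemma weq_hasTwoOutOfThreeProperty (hC : IsCylinderCategory Cof W) :
    (weq Cof W).HasTwoOutOfThreeProperty where
  comp_mem _ _ hf hg := hf.comp hC hg
  of_postcomp _ _ hg hfg := hg.of_comp_right hfg
  of_precomp _ _ hf hfg := hf.of_comp_left hC hfg

lemma weq_isStableUnderRetracts (hC : IsCylinderCategory Cof W) :
    (weq Cof W).IsStableUnderRetracts where
  of_retract {X Y X' Y' f f'} h hf' := by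
    rw [weq_iff_factorsThrough hC] at hf' ⊢
    intro A B i hi s t w
    have := hf' i hi (s ≫ h.i.left) (t ≫ h.i.right) (by
      rw [Category.assoc, h.i_w, reassoc_of% w])
    simpa using this.comp_right (f' := f) h.r.left h.r.right h.r_w

lemma tfae_weq (hC : IsCylinderCategory Cof W) {X X' : Completion Cof} (f : X ⟶ X') :
    List.TFAE [
      ∀ {A B : C} (i : A ⟶ B), Cof i → ∀ x : (y Cof).obj A ⟶ X,
        Function.Bijective (PiSet.map W i f x),
      ∀ {A B : C} (i : A ⟶ B), Cof i → ∀ x : (y Cof).obj A ⟶ X,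
        Function.Surjective (PiSet.map W i f x),
      weq Cof W f] := by
  tfae_have 1 → 2 := fun h _ _ i hi x ↦ (h i hi x).2
  tfae_have 2 → 3 := by
    intro h
    rw [weq_iff]
    intro A B i hi s t w
    obtain ⟨⟨a⟩, ha⟩ := h i hi s (Quot.mk _ ⟨t, w.symm⟩)
    exact ⟨a.1, a.2, ((equivalence_relHomotopic hC i hi _).quot_mk_eq_iff _ _).1 ha⟩
  tfae_have 3 → 1 := by
    intro hf A B i hi x
    constructor
    · rintro ⟨a⟩ ⟨b⟩ h
      exact Quot.sound (hf.htpy_of_comp hi (a.2.trans b.2.symm)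
        (((equivalence_relHomotopic hC i hi _).quot_mk_eq_iff _ _).1 h))
    · rintro ⟨t⟩
      obtain ⟨a, ha, h⟩ := hf.exists_lift hi x t.1 t.2.symm
      exact ⟨Quot.mk _ ⟨a, ha⟩, Quot.sound h⟩
  tfae_finish

end WeakEquivalences

/-! ### Coproducts from pushouts, composition and filtered colimits. -/

section ColimitClosure

variable {E : Type u} [Category.{v} E]

/-- Pushouts commute with colimits. -/
lemma nonempty_isColimit_of_isPushout {J : Type*} [Category* J] {F₁ F₂ F₃ F₄ : J ⥤ E}
    {α : F₁ ⟶ F₂} {β : F₁ ⟶ F₃} {γ : F₂ ⟶ F₄} {δ : F₃ ⟶ F₄}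
    (sq : ∀ j, IsPushout (α.app j) (β.app j) (γ.app j) (δ.app j))
    {c₁ : Cocone F₁} {c₂ : Cocone F₂} {c₃ : Cocone F₃} {c₄ : Cocone F₄}
    (h₁ : IsColimit c₁) (h₂ : IsColimit c₂) (h₃ : IsColimit c₃)
    {a : c₁.pt ⟶ c₂.pt} {b : c₁.pt ⟶ c₃.pt} {c : c₂.pt ⟶ c₄.pt} {d : c₃.pt ⟶ c₄.pt}
    (sq' : IsPushout a b c d) (ha : ∀ j, c₁.ι.app j ≫ a = α.app j ≫ c₂.ι.app j)
    (hb : ∀ j, c₁.ι.app j ≫ b = β.app j ≫ c₃.ι.app j)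
    (hc : ∀ j, c₂.ι.app j ≫ c = γ.app j ≫ c₄.ι.app j)
    (hd : ∀ j, c₃.ι.app j ≫ d = δ.app j ≫ c₄.ι.app j) : Nonempty (IsColimit c₄) := by
  have key (s : Cocone F₄) : ∃ l : c₄.pt ⟶ s.pt,
      c ≫ l = h₂.desc ((Cocone.precompose γ).obj s) ∧
      d ≫ l = h₃.desc ((Cocone.precompose δ).obj s) := by
    have w : a ≫ h₂.desc ((Cocone.precompose γ).obj s) =
        b ≫ h₃.desc ((Cocone.precompose δ).obj s) := by
      refine h₁.hom_ext fun j ↦ ?_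
      rw [reassoc_of% (ha j), reassoc_of% (hb j), h₂.fac, h₃.fac]
      simp [(sq j).w_assoc]
    exact ⟨sq'.desc _ _ w, by simp, by simp⟩
  choose l hl hl' using key
  refine ⟨{ desc := l, fac := fun s j ↦ (sq j).hom_ext ?_ ?_, uniq := fun s m hm ↦
    sq'.hom_ext (h₂.hom_ext fun j ↦ ?_) (h₃.hom_ext fun j ↦ ?_) }⟩
  · rw [← reassoc_of% (hc j), hl, h₂.fac]; rfl
  · rw [← reassoc_of% (hd j), hl', h₃.fac]; rfl
  · rw [reassoc_of% (hc j), reassoc_of% (hc j), hm, ← reassoc_of% (hc j), hl, h₂.fac]; rfl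
  · rw [reassoc_of% (hd j), reassoc_of% (hd j), hm, ← reassoc_of% (hd j), hl', h₃.fac]; rfl

variable (P : MorphismProperty E) [P.IsMultiplicative] [P.IsStableUnderCobaseChange]

/-- Change the components indexed by `T` first, then the remaining one: each stage is a pushout of a
map in `P`. -/
lemma isStableUnderCoproductsOfShape_option [HasPushouts E] [HasCoproducts.{w} E] (T : Type w)
    [P.IsStableUnderCoproductsOfShape T] : P.IsStableUnderCoproductsOfShape (Option T) := by
  refine .mk _ _ fun X₁ X₂ _ _ f hf ↦ ?_
  let g := Limits.Sigma.map (fun t ↦ f (some t))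
  have hg : P g := MorphismProperty.colimMap _ (fun t ↦ hf (some t.as))
  let k : ∐ (fun t ↦ X₁ (some t)) ⟶ ∐ X₁ := Sigma.desc fun t ↦ Sigma.ι X₁ (some t)
  let sq := IsPushout.of_hasPushout g k
  let sq' := IsPushout.of_hasPushout (f none) (Sigma.ι X₁ none ≫ pushout.inr g k)
  have hP := P.comp_mem _ _ (MorphismProperty.of_isPushout sq.flip hg)
    (MorphismProperty.of_isPushout sq'.flip (hf none))
  let a := sq.desc (Sigma.desc fun t ↦ Sigma.ι X₂ (some t)) (Limits.Sigma.map f)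
    (by ext t; simp [g, k])
  let e := sq'.desc (Sigma.ι X₂ none) a (by simp [a])
  let e' : ∐ X₂ ⟶ pushout (f none) (Sigma.ι X₁ none ≫ pushout.inr g k) :=
    Sigma.desc (fun t ↦ match t with
      | none => pushout.inl _ _
      | some t => Sigma.ι (fun t ↦ X₂ (some t)) t ≫ pushout.inl g k ≫ pushout.inr _ _)
  have he : e ≫ e' = 𝟙 _ := by
    refine sq'.hom_ext (by simp [e, e']) (sq.hom_ext ?_ ?_)
    · ext t
      simp [e, e', a]
    · ext (_ | t)
      · simpa [e, e', a] using sq'.w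
      · simpa [e, e', a, k, g] using
          Sigma.ι (fun t ↦ X₁ (some t)) t ≫= sq.w =≫
            pushout.inr (f none) (Sigma.ι X₁ none ≫ pushout.inr g k)
  have he' : e' ≫ e = 𝟙 _ := by
    ext (_ | t) <;> simp [e, e', a]
  have : IsIso e := ⟨e', he, he'⟩
  have h : Limits.Sigma.map f = (pushout.inr g k ≫ pushout.inr _ _) ≫ e := by
    simp [e, a]
  rw [h]
  exact P.comp_mem _ _ hP (P.of_isIso e)

lemma isStableUnderCoproductsOfShape_of_finite [HasPushouts E] [HasCoproducts.{w} E] (T : Type w)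
    [Finite T] : P.IsStableUnderCoproductsOfShape T := by
  induction T using Finite.induction_empty_option with
  | of_equiv e h =>
    refine (MorphismProperty.isStableUnderColimitsOfShape_iff_colimitsOfShape_le _ _).2 ?_
    replace h := (MorphismProperty.isStableUnderColimitsOfShape_iff_colimitsOfShape_le _ _).1 h
    rwa [← MorphismProperty.colimitsOfShape_eq_of_equivalence _ (Discrete.equivalence e)]
  | h_empty =>
    refine .mk _ _ fun X₁ X₂ _ _ f hf ↦ ?_
    have : IsIso (Limits.Sigma.map f) :=
      ⟨Sigma.desc (fun t ↦ t.elim), by ext t; exact t.elim, by ext t; exact t.elim⟩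
    exact P.of_isIso _
  | h_option h => exact isStableUnderCoproductsOfShape_option P _

lemma isStableUnderCoproducts_of_isStableUnderFilteredColimits [HasColimitsOfSize.{w, w} E]
    [HasFiniteColimits E] [MorphismProperty.IsStableUnderFilteredColimits.{w, w} P] :
    MorphismProperty.IsStableUnderCoproducts.{w} P where
  isStableUnderCoproductsOfShape T := by
    classical
    refine .mk _ _ fun X₁ X₂ _ _ f hf ↦ ?_
    refine MorphismProperty.IsStableUnderColimitsOfShape.condition _ _ _ _
      (CoproductsFromFiniteFiltered.isColimitFiniteSubproductsCocone X₁)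
      (CoproductsFromFiniteFiltered.isColimitFiniteSubproductsCocone X₂)
      ((CoproductsFromFiniteFiltered.liftToFinset E T).map (Discrete.natTrans fun t ↦ f t.as))
      (fun S ↦ ?_) _ (fun S ↦ ?_)
    · have := isStableUnderCoproductsOfShape_of_finite P S
      exact MorphismProperty.colimMap _ (fun t ↦ hf t.as.1.as)
    · refine Sigma.hom_ext _ _ fun t ↦ ?_
      have h : Sigma.ι (fun x : S ↦ X₁ x.1.as) t ≫ Sigma.desc (fun s ↦ Sigma.ι X₁ s.1.as) ≫
          Limits.Sigma.map f = Sigma.ι (fun x : S ↦ X₁ x.1.as) t ≫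
            Limits.Sigma.map (fun x ↦ f x.1.as) ≫ Sigma.desc (fun s ↦ Sigma.ι X₂ s.1.as) := by
        simp
      exact h

end ColimitClosure

/-! ### Flat objects as filtered colimits of representables. -/

section Flat

variable {C : Type u} [SmallCategory C] {Cof W : MorphismProperty C}

/-- The objects `X` of the completion whose category of elements is filtered: as `X` preserves
finite coproducts, only the last axiom of filtered categories is needed. -/
def IsFlat (X : Completion Cof) : Prop :=
  ∀ ⦃c d : C⦄ (u v : c ⟶ d) (x : (y Cof).obj d ⟶ X),
    (y Cof).map u ≫ x = (y Cof).map v ≫ x →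
      ∃ (k : C) (w : d ⟶ k) (z : (y Cof).obj k ⟶ X), u ≫ w = v ≫ w ∧ (y Cof).map w ≫ z = x

lemma isFlat_y (k : C) : IsFlat ((y Cof).obj k) := by
  intro c d u v x h
  obtain ⟨w, rfl⟩ := (y Cof).map_surjective x
  exact ⟨k, w, 𝟙 _, (y Cof).map_injective (by simpa using h), by simp⟩

lemma IsFlat.of_retract {X X' : Completion Cof} (r : Retract X X') (h : IsFlat X') : IsFlat X := by
  intro c d u v x hx
  obtain ⟨k, w, z, hw, hz⟩ := h u v (x ≫ r.i) (by rw [reassoc_of% hx])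
  exact ⟨k, w, z ≫ r.r, hw, by simp [reassoc_of% hz]⟩

lemma IsFlat.of_iso {X X' : Completion Cof} (e : X ≅ X') (h : IsFlat X') : IsFlat X :=
  h.of_retract e.retract

attribute [local instance] Cardinal.fact_isRegular_aleph0

lemma IsFlat.of_isColimit {J : Type u} [SmallCategory J] [IsFiltered J] {F : J ⥤ Completion Cof}
    {c : Cocone F} (hc : IsColimit c) (h : ∀ j, IsFlat (F.obj j)) : IsFlat c.pt := by
  intro a d u v x hx
  obtain ⟨j, x, rfl⟩ := IsFinitelyPresentable.exists_hom_of_isColimit hc x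
  obtain ⟨j', φ, hφ⟩ : ∃ (j' : J) (φ : j ⟶ j'),
      (y Cof).map u ≫ x ≫ F.map φ = (y Cof).map v ≫ x ≫ F.map φ := by
    obtain ⟨j', φ, ψ, h⟩ := IsFinitelyPresentable.exists_eq_of_isColimit hc
      ((y Cof).map u ≫ x) ((y Cof).map v ≫ x) (by simpa using hx)
    -- The two composites become equal along possibly different maps `φ` and `ψ`, which are
    -- coequalized further on.
    refine ⟨_, φ ≫ IsFiltered.coeqHom φ ψ, ?_⟩
    conv_rhs => rw [IsFiltered.coeq_condition]
    simp only [Functor.map_comp, Category.assoc] at h ⊢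
    rw [reassoc_of% h]
  obtain ⟨k, w, z, hw, hz⟩ := h j' u v (x ≫ F.map φ) hφ
  exact ⟨k, w, z ≫ c.ι.app j', hw, by simp [reassoc_of% hz]⟩

/-- Maps between objects of the completion are determined by, and can be defined on, elements. -/
lemma exists_hom_of_natural {X T : Completion Cof}
    (σ : ∀ ⦃c : C⦄, ((y Cof).obj c ⟶ X) → ((y Cof).obj c ⟶ T))
    (hσ : ∀ ⦃c d : C⦄ (k : c ⟶ d) (x : (y Cof).obj d ⟶ X),
      (y Cof).map k ≫ σ x = σ ((y Cof).map k ≫ x)) :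
    ∃ l : X ⟶ T, ∀ ⦃c : C⦄ (x : (y Cof).obj c ⟶ X), x ≫ l = σ x := by
  let τ {c : C} (x : X.obj.obj (op c)) : yoneda.obj c ⟶ T.obj :=
    (σ (ObjectProperty.homMk (yonedaEquiv.symm x))).hom
  have hτ {c d : C} (k : c ⟶ d) (x : X.obj.obj (op d)) :
      yoneda.map k ≫ τ x = τ (X.obj.map k.op x) := by
    have := congrArg InducedCategory.Hom.hom
      (hσ k (ObjectProperty.homMk (yonedaEquiv.symm x)))
    refine this.trans ?_
    have h : (y Cof).map k ≫ ObjectProperty.homMk (yonedaEquiv.symm x) =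
        ObjectProperty.homMk (yonedaEquiv.symm (X.obj.map k.op x)) :=
      InducedCategory.hom_ext (yonedaEquiv_symm_map k.op x).symm
    rw [h]
  let l : X.obj ⟶ T.obj :=
    { app := fun c ↦ ↾fun x ↦ yonedaEquiv (τ (c := c.unop) x)
      naturality := fun c d k ↦ by
        ext x
        exact (congrArg yonedaEquiv (hτ k.unop x)).symm.trans
          (yonedaEquiv_naturality (τ (c := c.unop) x) k.unop).symm }
  refine ⟨ObjectProperty.homMk l, fun c x ↦ InducedCategory.hom_ext (yonedaEquiv.injective ?_)⟩
  have h : (yonedaEquiv.symm (yonedaEquiv x.hom) : yoneda.obj c ⟶ X.obj) = x.hom :=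
    yonedaEquiv.symm_apply_apply _
  change yonedaEquiv (τ (yonedaEquiv x.hom)) = _
  simp only [τ, h]
  rfl

lemma hom_ext_y {X T : Completion Cof} {l m : X ⟶ T}
    (h : ∀ ⦃c : C⦄ (x : (y Cof).obj c ⟶ X), x ≫ l = x ≫ m) : l = m :=
  InducedCategory.hom_ext (hom_ext_yoneda fun _ x ↦
    congrArg InducedCategory.Hom.hom (h (ObjectProperty.homMk x)))

/-- The tautological cocone on the category of elements. -/
def elementsCocone (X : Completion Cof) : Cocone (CostructuredArrow.proj (y Cof) X ⋙ y Cof) where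
  pt := X
  ι := { app := fun j ↦ j.hom
         naturality := fun _ _ f ↦ (CostructuredArrow.w f).trans (Category.comp_id _).symm }

lemma nonempty_isColimit_elementsCocone (X : Completion Cof) :
    Nonempty (IsColimit (elementsCocone X)) := by
  have key (s : Cocone (CostructuredArrow.proj (y Cof) X ⋙ y Cof)) :
      ∃ l : X ⟶ s.pt, ∀ ⦃c : C⦄ (x : (y Cof).obj c ⟶ X),
        x ≫ l = s.ι.app (CostructuredArrow.mk x) :=
    exists_hom_of_natural (fun _ x ↦ s.ι.app (CostructuredArrow.mk x)) fun c d k x ↦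
      s.w (CostructuredArrow.homMk k : CostructuredArrow.mk ((y Cof).map k ≫ x) ⟶ .mk x)
  choose l hl using key
  exact ⟨{  desc := l
            fac := fun s j ↦ hl s j.hom
            uniq := fun s m hm ↦ hom_ext_y fun c x ↦
              (hm (CostructuredArrow.mk x)).trans (hl s x).symm }⟩

lemma IsFlat.isFiltered (hC : IsCylinderCategory Cof W) {X : Completion Cof} (hX : IsFlat X) :
    IsFiltered (CostructuredArrow (y Cof) X) where
  nonempty := by
    have := hC.hasInitial
    exact ⟨CostructuredArrow.mk ((nonempty_isInitial_y (Cof := Cof) initialIsInitial).some.to X)⟩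
  cocone_objs j j' := by
    have := hC.hasInitial
    let hZ := initialIsInitial (C := C)
    have hj := hC.cof_from_initial hZ j.left
    obtain ⟨k, u, v, sq⟩ := hC.exists_isPushout (hZ.to j.left) (hZ.to j'.left) hj
    have sq' := isPushout_y sq hj
    let z : (y Cof).obj k ⟶ X :=
      sq'.desc j.hom j'.hom ((nonempty_isInitial_y hZ).some.hom_ext _ _)
    exact ⟨CostructuredArrow.mk z, CostructuredArrow.homMk u (sq'.inl_desc _ _ _),
      CostructuredArrow.homMk v (sq'.inr_desc _ _ _), trivial⟩
  cocone_maps j j' f g := by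
    obtain ⟨k, w, z, hw, hz⟩ := hX f.left g.left j'.hom
      ((CostructuredArrow.w f).trans (CostructuredArrow.w g).symm)
    exact ⟨CostructuredArrow.mk z, CostructuredArrow.homMk w hz, by ext; exact hw⟩

end Flat

/-! ### Propagation along cellular maps with flat domain. -/

section FlatPushouts

variable {C : Type u} [SmallCategory C] {Cof W : MorphismProperty C}

attribute [local instance] Cardinal.fact_isRegular_aleph0

lemma weq_isStableUnderFilteredColimits (hC : IsCylinderCategory Cof W) :
    MorphismProperty.IsStableUnderFilteredColimits.{u, u} (weq Cof W) where
  isStableUnderColimitsOfShape J _ _ := ⟨by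
    intro X₁ X₂ c₁ c₂ h₁ h₂ f hf φ hφ
    rw [weq_iff_factorsThrough hC]
    intro A B i hi s t w
    obtain ⟨j, s, rfl⟩ := IsFinitelyPresentable.exists_hom_of_isColimit h₁ s
    obtain ⟨j', t, rfl⟩ := IsFinitelyPresentable.exists_hom_of_isColimit h₂ t
    obtain ⟨k, a, b, h⟩ := IsFinitelyPresentable.exists_eq_of_isColimit h₂ (s ≫ f.app j)
      ((y Cof).map i ≫ t) (by simpa [hφ] using w)
    have := ((weq_iff_factorsThrough hC _).1 (hf k) i hi (s ≫ X₁.map a) (t ≫ X₂.map b)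
      (by simpa using h)).comp_right (c₁.ι.app k) (c₂.ι.app k) (hφ k)
    simpa using this⟩

/-- The maps all of whose pushouts with flat domain have a flat codomain and belong to `N`. -/
def flatPushouts (N : MorphismProperty (Completion Cof)) : MorphismProperty (Completion Cof) :=
  fun X Z f ↦ ∀ ⦃X' Z' : Completion Cof⦄ (a : X ⟶ X') (b : Z ⟶ Z') (f' : X' ⟶ Z'),
    IsPushout f a b f' → IsFlat X' → IsFlat Z' ∧ N f'

variable (N : MorphismProperty (Completion Cof))

instance : (flatPushouts N).IsStableUnderCobaseChange where
  of_isPushout sq hf _ _ _ _ _ sq' := hf _ _ _ (sq.flip.paste_vert sq')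

instance [N.IsMultiplicative] [N.RespectsIso] : (flatPushouts N).IsMultiplicative where
  id_mem X X' Z' a b f' sq hX' := by
    have : IsIso f' := sq.isIso_inr_of_isIso
    exact ⟨hX'.of_iso (asIso f').symm, N.of_isIso f'⟩
  comp_mem f g hf hg X' Z' a b f' sq hX' := by
    have sq₁ := IsPushout.of_hasPushout f a
    obtain ⟨h, h'⟩ := hf _ _ _ sq₁ hX'
    let g' : pushout f a ⟶ Z' := sq₁.desc (g ≫ b) f' (by simpa using sq.w)
    have hg' : pushout.inr f a ≫ g' = f' := sq₁.inr_desc _ _ _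
    have sq₂ : IsPushout g (pushout.inl f a) b g' :=
      IsPushout.of_left (by rwa [hg']) (by simp [g']) sq₁
    obtain ⟨h₂, h₂'⟩ := hg _ _ _ sq₂ h
    exact ⟨h₂, hg' ▸ N.comp_mem _ _ h' h₂'⟩

instance [N.IsStableUnderRetracts] : (flatPushouts N).IsStableUnderRetracts where
  of_retract {X Z X₁ Z₁ f g} r hg X' Z' a b f' sq hX' := by
    have sq₁ := IsPushout.of_hasPushout g (r.r.left ≫ a)
    obtain ⟨h, h'⟩ := hg _ _ _ sq₁ hX'
    have hr : r.i.left ≫ r.r.left = 𝟙 _ := r.retract_left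
    have hr' : r.i.right ≫ r.r.right = 𝟙 _ := r.retract_right
    have w₁ : r.i.left ≫ g = f ≫ r.i.right := r.i_w
    have w₂ : r.r.left ≫ f = g ≫ r.r.right := r.r_w
    -- The retract diagram is the identity on `X'`, so flatness of `X'` suffices to use the
    -- hypothesis on `g`.
    let ρ : RetractArrow f' (pushout.inr g (r.r.left ≫ a)) :=
      { i := Arrow.homMk (𝟙 X') (sq.desc (r.i.right ≫ pushout.inl _ _) (pushout.inr _ _) (by
            rw [← reassoc_of% w₁, sq₁.w, ← Category.assoc, reassoc_of% hr])) (by simp)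
        r := Arrow.homMk (𝟙 X') (sq₁.desc (r.r.right ≫ b) f' (by
            rw [← reassoc_of% w₂, sq.w, Category.assoc])) (by simp)
        retract := by
          refine Arrow.hom_ext _ _ (Category.comp_id _) (sq.hom_ext ?_ ?_)
          · simp [reassoc_of% hr']
          · simp }
    exact ⟨h.of_retract ρ.right, MorphismProperty.of_retract ρ h'⟩

instance [MorphismProperty.IsStableUnderFilteredColimits.{u, u} N] :
    MorphismProperty.IsStableUnderFilteredColimits.{u, u} (flatPushouts N) where
  isStableUnderColimitsOfShape J _ _ := ⟨by
    intro X₁ X₂ c₁ c₂ h₁ h₂ f hf φ hφ X' Z' a b f' sq hX'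
    have := IsFiltered.isConnected J
    let β : X₁ ⟶ (Functor.const J).obj X' := c₁.ι ≫ (Functor.const J).map a
    have sq' := IsPushout.of_hasPushout f β
    have sqj (j : J) : IsPushout (f.app j) (β.app j) ((pushout.inl f β).app j)
        ((pushout.inr f β).app j) := sq'.map ((evaluation J (Completion Cof)).obj j)
    let c₄ : Cocone (pushout f β) :=
      { pt := Z'
        ι := sq'.desc (c₂.ι ≫ (Functor.const J).map b) ((Functor.const J).map f') (by
          refine NatTrans.ext (funext fun j ↦ ?_)
          simp [β, ← reassoc_of% (hφ j), sq.w]) }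
    have hc₄ : pushout.inl f β ≫ c₄.ι = c₂.ι ≫ (Functor.const J).map b := sq'.inl_desc _ _ _
    have hc₄' : pushout.inr f β ≫ c₄.ι = (Functor.const J).map f' := sq'.inr_desc _ _ _
    obtain ⟨h₄⟩ := nonempty_isColimit_of_isPushout sqj h₁ h₂ (isColimitConstCocone J X')
      (c₄ := c₄) sq hφ (fun j ↦ (Category.comp_id _).symm)
      (fun j ↦ (congr_app hc₄ j).symm) (fun j ↦ (Category.id_comp _).trans (congr_app hc₄' j).symm)
    have key (j : J) := hf j _ _ _ (sqj j) hX'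
    exact ⟨IsFlat.of_isColimit h₄ fun j ↦ (key j).1,
      MorphismProperty.IsStableUnderColimitsOfShape.condition _ _ _ _
        (isColimitConstCocone J X') h₄ (pushout.inr f β) (fun j ↦ (key j).2) f'
        (fun j ↦ (Category.id_comp _).trans (congr_app hc₄' j).symm)⟩⟩

/-- A pushout of a cofibration of `C` along a map to a flat object is a filtered colimit of
pushouts of this cofibration in `C`. -/
lemma flatPushouts_y_map (hC : IsCylinderCategory Cof W)
    [MorphismProperty.IsStableUnderFilteredColimits.{u, u} N] [N.RespectsIso] {A B : C} {i : A ⟶ B}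
    (hi : Cof i) (hN : ∀ ⦃A' B' : C⦄ (f : A ⟶ A') (g : B ⟶ B') (i' : A' ⟶ B'),
      IsPushout i f g i' → N ((y Cof).map i')) : flatPushouts N ((y Cof).map i) := by
  intro X' Z' a b f' sq hX'
  have := hX'.isFiltered hC
  let j₀ := CostructuredArrow.mk a
  -- Elements of `X'` under `a` are still final, and each `y c` in this diagram comes with a map `A
  -- ⟶ c` of `C` along which `i` can be pushed out in `C`.
  let J := Under j₀
  have := IsFiltered.isConnected J
  obtain ⟨h₃⟩ := nonempty_isColimit_elementsCocone X'
  let F₃ : J ⥤ Completion Cof := Under.forget j₀ ⋙ CostructuredArrow.proj _ _ ⋙ y Cof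
  let c₃ : Cocone F₃ := (elementsCocone X').whisker (Under.forget j₀)
  replace h₃ : IsColimit c₃ := (Functor.Final.isColimitWhiskerEquiv (Under.forget j₀) _).symm h₃
  let β : (Functor.const J).obj ((y Cof).obj A) ⟶ F₃ :=
    { app := fun j ↦ (y Cof).map j.hom.left
      naturality := fun j j' k ↦ by
        have h : j.hom.left ≫ k.right.left = j'.hom.left := congrArg CommaMorphism.left (Under.w k)
        exact (Category.id_comp _).trans
          (((y Cof).congr_map h).symm.trans ((y Cof).map_comp _ _)) }
  let α : (Functor.const J).obj ((y Cof).obj A) ⟶ (Functor.const J).obj ((y Cof).obj B) :=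
    (Functor.const J).map ((y Cof).map i)
  have sq' := IsPushout.of_hasPushout α β
  have sqj (j : J) : IsPushout (α.app j) (β.app j) ((pushout.inl α β).app j)
        ((pushout.inr α β).app j) := sq'.map ((evaluation J (Completion Cof)).obj j)
  have hβ (j : J) : (y Cof).map j.hom.left ≫ c₃.ι.app j = a := CostructuredArrow.w j.hom
  let c₄ : Cocone (pushout α β) :=
    { pt := Z'
      ι := sq'.desc ((Functor.const J).map b) (c₃.ι ≫ (Functor.const J).map f') (by
        refine NatTrans.ext (funext fun j ↦ ?_)
        exact (sq.w.trans (congrArg (· ≫ f') (hβ j)).symm).trans (Category.assoc _ _ _)) }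
  have hc₄ : pushout.inl α β ≫ c₄.ι = (Functor.const J).map b := sq'.inl_desc _ _ _
  have hc₄' : pushout.inr α β ≫ c₄.ι = c₃.ι ≫ (Functor.const J).map f' := sq'.inr_desc _ _ _
  obtain ⟨h₄⟩ := nonempty_isColimit_of_isPushout sqj (isColimitConstCocone J _)
    (isColimitConstCocone J _) h₃ (c₄ := c₄) sq
    (fun j ↦ (Category.id_comp _).trans (Category.comp_id _).symm)
    (fun j ↦ (Category.id_comp _).trans (hβ j).symm)
    (fun j ↦ (Category.id_comp _).trans (congr_app hc₄ j).symm)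
    (fun j ↦ (congr_app hc₄' j).symm)
  have key (j : J) : IsFlat ((pushout α β).obj j) ∧ N ((pushout.inr α β).app j) := by
    obtain ⟨P, l, r, hP⟩ := hC.exists_isPushout i j.hom.left hi
    let e := (isPushout_y hP hi).isoIsPushout _ _ (sqj j)
    refine ⟨(isFlat_y P).of_iso e.symm, ?_⟩
    have h : (pushout.inr α β).app j = (y Cof).map r ≫ e.hom :=
      (IsPushout.inr_isoIsPushout_hom ..).symm
    rw [h]
    exact (N.cancel_right_of_respectsIso _ _).2 (hN _ _ _ hP)
  exact ⟨IsFlat.of_isColimit h₄ fun j ↦ (key j).1,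
    MorphismProperty.IsStableUnderColimitsOfShape.condition _ _ _ _ h₃ h₄ (pushout.inr α β)
      (fun j ↦ (key j).2) f' (fun j ↦ (congr_app hc₄' j).symm)⟩

lemma llp_rlp_le_flatPushouts [N.IsMultiplicative] [N.IsStableUnderRetracts]
    [MorphismProperty.IsStableUnderFilteredColimits.{u, u} N]
    {I : MorphismProperty (Completion Cof)} [MorphismProperty.HasSmallObjectArgument.{u} I]
    (hI : I ≤ flatPushouts N) : I.rlp.llp ≤ flatPushouts N := by
  have : MorphismProperty.IsStableUnderCoproducts.{u} (flatPushouts N) :=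
    isStableUnderCoproducts_of_isStableUnderFilteredColimits _
  rw [I.llp_rlp_of_hasSmallObjectArgument, MorphismProperty.retracts_le_iff,
    MorphismProperty.transfiniteCompositions_le_iff, MorphismProperty.pushouts_le_iff,
    MorphismProperty.coproducts_le_iff]
  exact hI

end FlatPushouts

/-! ### The semi-model structure. -/

section SemiModelStructure

variable {C : Type u} [SmallCategory C] {Cof W : MorphismProperty C}

lemma IsCofibrantObject.isFlat (hC : IsCylinderCategory Cof W) {X : Completion Cof}
    (hX : IsCofibrantObject (cof Cof) X) : IsFlat X := by
  have := hC.hasInitial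
  have hZ := (nonempty_isInitial_y (Cof := Cof) (initialIsInitial (C := C))).some
  have h := hX hZ
  rw [cof_eq_llp_rlp] at h
  have : MorphismProperty.IsStableUnderFilteredColimits.{u, u}
      (⊤ : MorphismProperty (Completion Cof)) :=
    { isStableUnderColimitsOfShape := fun _ _ _ ↦ ⟨by intros; trivial⟩ }
  have : (⊤ : MorphismProperty (Completion Cof)).IsStableUnderRetracts :=
    { of_retract := fun _ _ ↦ trivial }
  have hI : genCof Cof ≤ flatPushouts ⊤ := by
    rintro _ _ _ ⟨hi⟩
    exact flatPushouts_y_map _ hC hi (fun _ _ _ _ _ _ ↦ trivial)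
  -- `0 ⟶ X` is a pushout of itself, and its domain is representable, hence flat.
  exact (llp_rlp_le_flatPushouts ⊤ hI _ h _ _ _ IsPushout.of_id_snd (isFlat_y _)).1

lemma weq_of_llp_fib (hC : IsCylinderCategory Cof W) {X Y : Completion Cof} {f : X ⟶ Y}
    (hX : IsCofibrantObject (cof Cof) X) (hf : (fib Cof W).llp f) : weq Cof W f := by
  have := weq_isMultiplicative hC
  have := weq_isStableUnderRetracts hC
  have := weq_isStableUnderFilteredColimits hC
  have hJ : genTrivCof Cof W ≤ flatPushouts (weq Cof W) := by
    rintro _ _ _ ⟨hi⟩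
    refine flatPushouts_y_map _ hC hi.1 fun A' B' _ _ i' sq ↦ ?_
    have hi' := hC.trivialCof_pushout sq hi.1 hi.2
    refine weq_of_factorsThrough hC fun A B i _ s t w ↦ ?_
    obtain ⟨s, rfl⟩ := (y Cof).map_surjective s
    obtain ⟨t, rfl⟩ := (y Cof).map_surjective t
    -- By full faithfulness the square lives in `C`, so it factors through the weak equivalence `i'`
    -- itself.
    exact ⟨A', B', i', s, t, 𝟙 _, 𝟙 _, hi'.2, (y Cof).map_injective (by simpa using w.symm),
      by simp, by simp, by simp⟩
  exact (llp_rlp_le_flatPushouts _ hJ _ hf _ _ _ IsPushout.of_id_snd (hX.isFlat hC)).2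

instance : MorphismProperty.HasFunctorialFactorization (fib Cof W).llp (fib Cof W) :=
  inferInstanceAs (MorphismProperty.HasFunctorialFactorization
    (genTrivCof Cof W).rlp.llp (genTrivCof Cof W).rlp)

lemma llp_fib_iff (hC : IsCylinderCategory Cof W) {X Y : Completion Cof} (f : X ⟶ Y)
    (hX : IsCofibrantObject (cof Cof) X) :
    (fib Cof W).llp f ↔ cof Cof f ∧ weq Cof W f := by
  refine ⟨fun hf ↦ ⟨llp_fib_le_cof _ hf, weq_of_llp_fib hC hX hf⟩, fun ⟨hf, hf'⟩ ↦ ?_⟩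
  let d := MorphismProperty.factorizationData (fib Cof W).llp (fib Cof W) f
  have hi := weq_of_llp_fib hC hX d.hi
  have hp := (fib_and_weq_iff hC _).1 ⟨d.hp, hi.of_comp_left hC (by rwa [d.fac])⟩
  rw [cof_eq_llp_rlp] at hf
  have := hf _ hp
  exact MorphismProperty.of_retract (RetractArrow.ofLeftLiftingProperty d.fac) d.hi

lemma isFibrantObject (hC : IsCylinderCategory Cof W) (X : Completion Cof) :
    IsFibrantObject (fib Cof W) X := by
  rintro T hT _ _ _ ⟨hi⟩
  obtain ⟨r, hr⟩ := hC.exists_retraction _ hi.1 hi.2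
  exact ⟨fun {s t} sq ↦ ⟨⟨{ l := (y Cof).map r ≫ s
                            fac_left := by simp [← Functor.map_comp_assoc, hr]
                            fac_right := hT.hom_ext _ _ }⟩⟩⟩

lemma isSemiModelCategory (hC : IsCylinderCategory Cof W) :
    IsSemiModelCategory (cof Cof) (fib Cof W) (weq Cof W) where
  hasLimits := inferInstance
  hasColimits := inferInstance
  cof_isMultiplicative := by rw [cof_eq_llp_rlp]; infer_instance
  fib_isMultiplicative := by dsimp [fib]; infer_instance
  weq_isMultiplicative := weq_isMultiplicative hC
  two_out_of_three := weq_hasTwoOutOfThreeProperty hC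
  cof_retract := by rw [cof_eq_llp_rlp]; infer_instance
  fib_retract := by dsimp [fib]; infer_instance
  weq_retract := weq_isStableUnderRetracts hC
  fib_baseChange := by dsimp [fib]; infer_instance
  trivialFib_baseChange := by
    have : fib Cof W ⊓ weq Cof W = (genCof Cof).rlp := by
      ext X Y f
      exact fib_and_weq_iff hC f
    rw [this]
    infer_instance
  initial_cofibrant {Z} hZ Z' hZ' := by
    have : IsIso (hZ'.to Z) := (hZ'.uniqueUpToIso hZ).isIso_hom
    rw [cof_eq_llp_rlp]
    exact MorphismProperty.llp_of_isIso _ _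
  lift_cof i p hi hp hp' := by
    rw [cof_eq_llp_rlp] at hi
    exact hi _ ((fib_and_weq_iff hC p).1 ⟨hp, hp'⟩)
  lift_acyclicCof i p hA hi hi' hp := (llp_fib_iff hC i hA).2 ⟨hi, hi'⟩ _ hp
  factor_trivialFib := by
    have : fib Cof W ⊓ weq Cof W = (genCof Cof).rlp := by
      ext X Y f
      exact fib_and_weq_iff hC f
    rw [this, cof_eq_llp_rlp]
    infer_instance
  factor_acyclicCof := by
    -- This factors every arrow; a cofibrant domain serves only to make the left factor a weak
    -- equivalence.
    let d := MorphismProperty.functorialFactorizationData (fib Cof W).llp (fib Cof W)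
    refine ⟨(cofibrantDomain (cof Cof)).ι ⋙ d.Z,
      Functor.whiskerLeft (cofibrantDomain (cof Cof)).ι d.i,
      Functor.whiskerLeft (cofibrantDomain (cof Cof)).ι d.p, ?_, fun f ↦ ?_⟩
    · rw [← Functor.whiskerLeft_comp, d.fac]
    · have h := (llp_fib_iff hC _ f.property).1 (d.hi f.obj)
      exact ⟨h.1, h.2, d.hp f.obj⟩

lemma isCombinatorialSemiModelCategory (hC : IsCylinderCategory Cof W) :
    IsCombinatorialSemiModelCategory.{u + 1, u, u} (cof Cof) (fib Cof W) (weq Cof W)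
      (genCof Cof) (genTrivCof Cof W) where
  toIsSemiModelCategory := isSemiModelCategory hC
  isLocallyPresentable := ⟨Cardinal.aleph0, Cardinal.fact_isRegular_aleph0, inferInstance⟩
  isSmall_I := isSmall_strictMap_y _
  isSmall_J := isSmall_strictMap_y _
  fib_iff _ := Iff.rfl
  trivialFib_iff p := fib_and_weq_iff hC p

end SemiModelStructure

end CylinderCat

theorem mainTheorem3 {C : Type u} [SmallCategory C] (Cof W : MorphismProperty C)
    (hC : CylinderCat.IsCylinderCategory Cof W) :
    CylinderCat.IsCombinatorialSemiModelCategory.{u + 1, u, u}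
      (CylinderCat.cof Cof) (CylinderCat.fib Cof W) (CylinderCat.weq Cof W)
      (CylinderCat.genCof Cof) (CylinderCat.genTrivCof Cof W) ∧
    (∀ X : CylinderCat.Completion Cof,
      CylinderCat.IsFibrantObject (CylinderCat.fib Cof W) X) ∧
    (∀ {X Y : CylinderCat.Completion Cof} (f : X ⟶ Y),
      CylinderCat.IsCofibrantObject (CylinderCat.cof Cof) X →
        ((CylinderCat.fib Cof W).llp f ↔
          CylinderCat.cof Cof f ∧ CylinderCat.weq Cof W f)) ∧
    (∀ {A B : C} (i : A ⟶ B), Cof i → ∀ {X : CylinderCat.Completion Cof}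
      (x : (CylinderCat.y Cof).obj A ⟶ X),
      Equivalence (CylinderCat.RelHomotopic W i x)) ∧
    (∀ {X X' : CylinderCat.Completion Cof} (f : X ⟶ X'),
      List.TFAE [
        ∀ {A B : C} (i : A ⟶ B), Cof i → ∀ x : (CylinderCat.y Cof).obj A ⟶ X,
          Function.Bijective (CylinderCat.PiSet.map W i f x),
        ∀ {A B : C} (i : A ⟶ B), Cof i → ∀ x : (CylinderCat.y Cof).obj A ⟶ X,
          Function.Surjective (CylinderCat.PiSet.map W i f x),
        CylinderCat.weq Cof W f]) :=
  ⟨CylinderCat.isCombinatorialSemiModelCategory hC, CylinderCat.isFibrantObject hC,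
    CylinderCat.llp_fib_iff hC, fun i hi _ x ↦ CylinderCat.equivalence_relHomotopic hC i hi x,
    CylinderCat.tfae_weq hC⟩
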